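/- Consider the linear time-invariant plant $$\dot x=Ax+B_2u+B_1w,\qquad z=C_1x+D_{12}u,\qquad y=C_2x+D_{21}w,$$ with real matrices and $x\in\mathbb R^n$, $w,z\in\mathbb R^m$, $u\in\mathbb R^q$, $y\in\mathbb R^p$. Definitions (eigenvalues are counted with algebraic multiplicity). A real square matrix of size $N$ is *Hurwitz* if all its eigenvalues have negative real part, and *pseudo-Hurwitz* if $N-1$ of its eigenvalues have negative real part and one has positive real part. A real symmetric matrix of size $N$ is *pseudo-positive definite* if it has $N-1$ positive eigenvalues and one negative eigenvalue. A system $\dot\xi=\mathcal A\xi+\mathcal Bw$, $z=\mathcal C\xi$ with transfer function $G(s)=\mathcal C(sI-\mathcal A)^{-1}\mathcal B$ is *pseudo strict bounded real* if $\mathcal A$ is pseudo-Hurwitz and $\max_{\omega\in\mathbb R}\sigma_{\max}\big[G(-j\omega)^TG(j\omega)\big]<1$, where $\sigma_{\max}$ is the largest singular value. Theorem. Assume that $E_1=D_{12}^TD_{12}>0$ and $E_2=D_{21}D_{21}^T>0$, and that the following conditions hold. (i) $X=X^T\in\mathbb R^{n\times n}$ is a pseudo-positive definite stabilizing solution of $$(A-B_2E_1^{-1}D_{12}^TC_1)^TX+X(A-B_2E_1^{-1}D_{12}^TC_1)+X(B_1B_1^T-B_2E_1^{-1}B_2^T)X+C_1^T(I-D_{12}E_1^{-1}D_{12}^T)C_1=0,$$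 where stabilizing means that $A-B_2E_1^{-1}D_{12}^TC_1+(B_1B_1^T-B_2E_1^{-1}B_2^T)X$ is Hurwitz. (ii) $Y=Y^T\in\mathbb R^{n\times n}$ is a positive definite stabilizing solution of $$(A-B_1D_{21}^TE_2^{-1}C_2)Y+Y(A-B_1D_{21}^TE_2^{-1}C_2)^T+Y(C_1^TC_1-C_2^TE_2^{-1}C_2)Y+B_1(I-D_{21}^TE_2^{-1}D_{21})B_1^T=0,$$ where stabilizing means that $A-B_1D_{21}^TE_2^{-1}C_2+Y(C_1^TC_1-C_2^TE_2^{-1}C_2)$ is Hurwitz. (iii) The spectral radius satisfies $\rho(XY)<1$. Then $I-YX$ is invertible, and there is a compensator $\dot x_c=A_cx_c+B_cy$, $u=C_cx_c$ with $x_c\in\mathbb R^n$ for which the closed-loop system from $w$ to $z$, $$\begin{bmatrix}\dot x\\ \dot x_c\end{bmatrix}=\begin{bmatrix}A&B_2C_c\\ B_cC_2&A_c\end{bmatrix}\begin{bmatrix}x\\ x_c\end{bmatrix}+\begin{bmatrix}B_1\\ B_cD_{21}\end{bmatrix}w,\qquad z=\begin{bmatrix}C_1&D_{12}C_c\end{bmatrix}\begin{bmatrix}x\\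 x_c\end{bmatrix},$$ is pseudo strict bounded real; namely, it is given by $$C_c=-E_1^{-1}(B_2^TX+D_{12}^TC_1),\qquad B_c=(I-YX)^{-1}(YC_2^T+B_1D_{21}^T)E_2^{-1},$$ $$A_c=A+B_2C_c-B_cC_2+(B_1-B_cD_{21})B_1^TX.$$ -/

import Mathlib

open Matrix

noncomputable section

namespace PseudoHInf

/-- All eigenvalues of the real matrix `M` have negative real part. -/
def IsHurwitz {ι : Type*} [Fintype ι] [DecidableEq ι] (M : Matrix ι ι ℝ) : Prop :=
  ∀ s ∈ spectrum ℂ (M.map Complex.ofReal), s.re < 0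

/-- Of the eigenvalues of the real matrix `M` (the complex roots of its characteristic polynomial,
counted with algebraic multiplicity), all but one have negative real part and one has positive
real part. -/
def IsPseudoHurwitz {ι : Type*} [Fintype ι] [DecidableEq ι] (M : Matrix ι ι ℝ) : Prop :=
  (M.map Complex.ofReal).charpoly.roots.countP (fun s => s.re < 0) + 1 = Fintype.card ι ∧
    (M.map Complex.ofReal).charpoly.roots.countP (fun s => 0 < s.re) = 1

/-- `P` is symmetric and, counting multiplicities, all but one of its eigenvalues are positive
and one is negative. -/
def IsPseudoPosDef {ι : Type*} [Fintype ι] [DecidableEq ι] (P : Matrix ι ι ℝ) : Prop :=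
  P.IsSymm ∧ P.charpoly.roots.countP (fun r => 0 < r) + 1 = Fintype.card ι ∧
    P.charpoly.roots.countP (fun r => r < 0) = 1

/-- The spectral radius of a real matrix, over its complex eigenvalues. -/
def specRadius {ι : Type*} [Fintype ι] [DecidableEq ι] (M : Matrix ι ι ℝ) : ENNReal :=
  spectralRadius ℂ (M.map Complex.ofReal)

/-- The largest singular value of a complex matrix (singular values are indexed from `0` in
decreasing order). -/
def sigmaMax {κ ι : Type*} [Fintype κ] [Fintype ι] [DecidableEq ι] (M : Matrix κ ι ℂ) : ℝ :=
  (Matrix.toEuclideanLin M).singularValues 0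

/-- The linear time-invariant system `x' = A x + B w`, `z = C x`, with states indexed by `ι`,
inputs by `κ` and outputs by `o`. -/
structure LTISystem (ι κ o : Type*) where
  A : Matrix ι ι ℝ
  B : Matrix ι κ ℝ
  C : Matrix o ι ℝ

/-- The transfer function `G(s) = C (s I - A)⁻¹ B`. -/
def LTISystem.transfer {ι κ o : Type*} [Fintype ι] [DecidableEq ι]
    (S : LTISystem ι κ o) (s : ℂ) : Matrix o κ ℂ :=
  S.C.map Complex.ofReal * (s • (1 : Matrix ι ι ℂ) - S.A.map Complex.ofReal)⁻¹ *
    S.B.map Complex.ofReal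

/-- The system is pseudo strict bounded real: `A` is pseudo-Hurwitz, and the maximum over real
`ω` of `σ_max (G(-jω)ᵀ G(jω))` exists and is less than one. -/
def LTISystem.IsPseudoStrictBoundedReal {ι κ o : Type*} [Fintype ι] [DecidableEq ι]
    [Fintype κ] [DecidableEq κ] [Fintype o] (S : LTISystem ι κ o) : Prop :=
  IsPseudoHurwitz S.A ∧
    ∃ M : ℝ, IsGreatest (Set.range fun ω : ℝ =>
      sigmaMax ((S.transfer (-(Complex.I * (ω : ℂ))))ᵀ * S.transfer (Complex.I * (ω : ℂ)))) M ∧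
      M < 1

/-- The plant `x' = A x + B₂ u + B₁ w`, `z = C₁ x + D₁₂ u`, `y = C₂ x + D₂₁ w` with
`x ∈ ℝⁿ`, `w, z ∈ ℝᵐ`, `u ∈ ℝ^q`, `y ∈ ℝᵖ`. -/
structure Plant (n m q p : ℕ) where
  A : Matrix (Fin n) (Fin n) ℝ
  B₁ : Matrix (Fin n) (Fin m) ℝ
  B₂ : Matrix (Fin n) (Fin q) ℝ
  C₁ : Matrix (Fin m) (Fin n) ℝ
  C₂ : Matrix (Fin p) (Fin n) ℝ
  D₁₂ : Matrix (Fin m) (Fin q) ℝ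
  D₂₁ : Matrix (Fin p) (Fin m) ℝ

/-- The compensator `x_c' = A_c x_c + B_c y`, `u = C_c x_c`, with `x_c ∈ ℝᵏ`. -/
structure Compensator (k q p : ℕ) where
  Ac : Matrix (Fin k) (Fin k) ℝ
  Bc : Matrix (Fin k) (Fin p) ℝ
  Cc : Matrix (Fin q) (Fin k) ℝ

variable {n m q p : ℕ}

/-- The closed-loop system from `w` to `z`, with state `(x, x_c)`. -/
def Plant.closedLoop {k : ℕ} (S : Plant n m q p) (K : Compensator k q p) :
    LTISystem (Fin n ⊕ Fin k) (Fin m) (Fin m) where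
  A := Matrix.fromBlocks S.A (S.B₂ * K.Cc) (K.Bc * S.C₂) K.Ac
  B := Matrix.fromRows S.B₁ (K.Bc * S.D₂₁)
  C := Matrix.fromCols S.C₁ (S.D₁₂ * K.Cc)

/-- `E₁ = D₁₂ᵀ D₁₂`. -/
def Plant.E₁ (S : Plant n m q p) : Matrix (Fin q) (Fin q) ℝ := S.D₁₂ᵀ * S.D₁₂

/-- `E₂ = D₂₁ D₂₁ᵀ`. -/
def Plant.E₂ (S : Plant n m q p) : Matrix (Fin p) (Fin p) ℝ := S.D₂₁ * S.D₂₁ᵀ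

/-- `X` is a stabilizing symmetric solution of the Riccati equation
`Fᵀ X + X F + X R X + Q = 0`: the matrix `F + R X` is Hurwitz. -/
def IsStabilizingSolution {ι : Type*} [Fintype ι] [DecidableEq ι]
    (F R Q X : Matrix ι ι ℝ) : Prop :=
  X.IsSymm ∧ Fᵀ * X + X * F + X * R * X + Q = 0 ∧ IsHurwitz (F + R * X)

/-- `X` is a stabilizing solution of the control Riccati equation. -/
def Plant.IsStabilizingX (S : Plant n m q p) (X : Matrix (Fin n) (Fin n) ℝ) : Prop :=
  IsStabilizingSolution
    (S.A - S.B₂ * S.E₁⁻¹ * S.D₁₂ᵀ * S.C₁)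
    (S.B₁ * S.B₁ᵀ - S.B₂ * S.E₁⁻¹ * S.B₂ᵀ)
    (S.C₁ᵀ * (1 - S.D₁₂ * S.E₁⁻¹ * S.D₁₂ᵀ) * S.C₁) X

/-- `Y` is a stabilizing solution of the filter Riccati equation
`F Y + Y Fᵀ + Y R Y + Q = 0`; it is the equation above with `Fᵀ` in place of `F`, and stabilizing
means that `Fᵀ + R Y`, equivalently its transpose `F + Y R`, is Hurwitz. -/
def Plant.IsStabilizingY (S : Plant n m q p) (Y : Matrix (Fin n) (Fin n) ℝ) : Prop :=
  IsStabilizingSolution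
    (S.A - S.B₁ * S.D₂₁ᵀ * S.E₂⁻¹ * S.C₂)ᵀ
    (S.C₁ᵀ * S.C₁ - S.C₂ᵀ * S.E₂⁻¹ * S.C₂)
    (S.B₁ * (1 - S.D₂₁ᵀ * S.E₂⁻¹ * S.D₂₁) * S.B₁ᵀ) Y

end PseudoHInf

end

open Matrix

noncomputable section

namespace PseudoHInf

open Module Filter Topology

/-! Use the coordinates `(x, x - x_c)` and put `W = Y⁻¹ - X`. The bound `ρ(XY) < 1` is what makes
`W` positive definite (`posDef_inv_sub_of_specRadius_lt_one`), and then `1 - Y X = Y W` is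
invertible. In these coordinates `P = diag(X, W)` solves the bounded real Riccati equation of the
closed loop `(A, B, C)`. Its state block is the control equation, its off-diagonal blocks vanish by
the choice of `C_c`, and its error block is the filter equation, conjugated by `Y⁻¹`, minus the
control equation. Moreover `A + B Bᵀ P` is block triangular: the stabilizing property of `X` makes
one diagonal block Hurwitz, that of `Y` makes the other antistable, so there is no imaginary
eigenvalue.

The rest is a bounded real lemma for indefinite `P` (`isPseudoStrictBoundedReal_of_riccati`). By
`dissipation`, `x* P x` is nonincreasing along `x' = A x`, and both an imaginary eigenvalue of `A`
and a frequency at which the gain reaches one would produce an imaginary eigenvalue of `A + B Bᵀ P`.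
Since `P` has exactly one negative square, a Lyapunov argument (`countP_roots_of_lyapunov`) gives
`A` exactly one unstable eigenvalue. The transfer function vanishes at infinity, so the maximal gain
is attained and is less than one. -/

/-! ### Orbits on stable generalized eigenspaces. -/

/-- A nonnegative sequence driven by a geometrically decaying perturbation of a contraction decays
geometrically. -/
theorem exists_geometric_bound {a : ℕ → ℝ} {μ C r : ℝ} (hμ₀ : 0 ≤ μ) (hμ : μ < 1)
    (hr₀ : 0 ≤ r) (hr : r < 1) (hC : 0 ≤ C) (ha : ∀ n, a (n + 1) ≤ μ * a n + C * r ^ n) :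
    ∃ D s : ℝ, 0 ≤ D ∧ 0 ≤ s ∧ s < 1 ∧ ∀ n, a n ≤ D * s ^ n := by
  obtain ⟨s, hs, hs1⟩ := exists_between (max_lt hμ hr : max μ r < 1)
  have hμs : μ < s := (le_max_left μ r).trans_lt hs
  have hrs : r < s := (le_max_right μ r).trans_lt hs
  have hs0 : 0 ≤ s := hμ₀.trans hμs.le
  -- The first entry of the maximum starts the induction. The second gives `C ≤ D (s - μ)`, which
  -- with `r < s` closes the inductive step.
  refine ⟨max (a 0) (C / (s - μ)), s, (div_nonneg hC (sub_pos.2 hμs).le).trans (le_max_right _ _),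
    hs0, hs1, fun n => ?_⟩
  set D : ℝ := max (a 0) (C / (s - μ))
  have hD : C ≤ D * (s - μ) := (div_le_iff₀ (sub_pos.2 hμs)).1 (le_max_right _ _)
  induction n with
  | zero => rw [pow_zero, mul_one]; exact le_max_left (a 0) _
  | succ n ih =>
    calc a (n + 1) ≤ μ * a n + C * r ^ n := ha n
      _ ≤ μ * (D * s ^ n) + D * (s - μ) * s ^ n := by gcongr
      _ = D * s ^ (n + 1) := by ring

section Orbit

variable {V : Type*} [NormedAddCommGroup V] [NormedSpace ℂ V]

/-- The vectors whose orbit under `M` tends to zero. -/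
def vanishingOrbit (M : End ℂ V) : Submodule ℂ V where
  carrier := {x | Tendsto (fun n : ℕ => (M ^ n) x) atTop (𝓝 0)}
  zero_mem' := by simp
  add_mem' {x y} hx hy := by simpa using Tendsto.add hx hy
  smul_mem' c x hx := by simpa using Tendsto.const_smul hx c

/-- If `M - μ = κ g (f - l)` for some `g` commuting with `f`, and `‖μ‖ < 1`, then the orbits under
`M` of generalized eigenvectors of `f` for `l` decay geometrically. -/
theorem exists_geometric_bound_of_mem_genEigenspace {f g M : End ℂ V} (hfg : Commute f g)
    {l μ κ : ℂ} (hM : M - algebraMap ℂ _ μ = κ • (g * (f - algebraMap ℂ _ l))) (hμ : ‖μ‖ < 1)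
    (k : ℕ) (x : V) (hx : ((f - algebraMap ℂ _ l) ^ k) x = 0) :
    ∃ D s : ℝ, 0 ≤ D ∧ 0 ≤ s ∧ s < 1 ∧ ∀ n, ‖(M ^ n) x‖ ≤ D * s ^ n := by
  induction k generalizing x with
  | zero => exact ⟨0, 0, le_rfl, le_rfl, one_pos, fun n => by simp [show x = 0 by simpa using hx]⟩
  | succ k ih =>
    set h := f - algebraMap ℂ (End ℂ V) l
    have hgh : Commute g (h ^ k) :=
      ((hfg.symm.sub_right (Algebra.commutes l g).symm)).pow_right k
    -- Since `M x = μ x + κ g h x` and `h ^ k` kills the last term, the induction hypothesis makes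
    -- that term a geometric perturbation of a contraction by `‖μ‖`.
    obtain ⟨C, r, hC, hr0, hr1, hb⟩ := ih (κ • (g * h) x) (by
      rw [map_smul, ← Module.End.mul_apply, ← mul_assoc, ← hgh.eq, mul_assoc, ← pow_succ,
        Module.End.mul_apply, hx, map_zero, smul_zero])
    refine exists_geometric_bound (norm_nonneg μ) hμ hr0 hr1 hC fun n => ?_
    have hMx : M x = μ • x + κ • (g * h) x := by
      have := congrArg (fun φ : End ℂ V => φ x) hM
      simp only [LinearMap.sub_apply, Module.algebraMap_end_apply, LinearMap.smul_apply] at this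
      rw [← this]; abel
    rw [pow_succ, Module.End.mul_apply, hMx, map_add, map_smul]
    exact (norm_add_le _ _).trans (add_le_add (norm_smul_le _ _) (hb n))

/-- A Cayley transform of `f` maps orbits of stable generalized eigenvectors to orbits tending to
zero. -/
theorem maxGenEigenspace_le_vanishingOrbit {f g : End ℂ V} {c : ℝ} (hc : 0 < c)
    (hg : (algebraMap ℂ _ (c : ℂ) - f) * g = 1) (hg' : g * (algebraMap ℂ _ (c : ℂ) - f) = 1)
    {l : ℂ} (hl : l.re < 0) :
    f.maxGenEigenspace l ≤ vanishingOrbit ((algebraMap ℂ _ (c : ℂ) + f) * g) := by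
  intro x hx
  obtain ⟨k, hk⟩ := Module.End.mem_maxGenEigenspace f l x |>.1 hx
  have hfg : Commute f g := by
    have h1 : g * ((algebraMap ℂ _ (c : ℂ) - f) * f) * g =
        g * (f * (algebraMap ℂ _ (c : ℂ) - f)) * g := by
      congr 2
      rw [sub_mul, mul_sub, Algebra.commutes]
    rw [mul_assoc g (f * _) g, mul_assoc f, hg, mul_one, ← mul_assoc, hg', one_mul] at h1
    exact h1
  have hcl : (c : ℂ) - l ≠ 0 := fun h => by
    have := congrArg Complex.re h
    simp at this
    linarith
  -- The Cayley transform sends `l` to `(c + l) / (c - l)`, of modulus less than one because `c > 0`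
  -- and `Re l < 0`. The difference of the two transforms is `2c / (c - l) · (c - f)⁻¹ (f - l)`.
  obtain ⟨D, s, hD, hs0, hs1, hb⟩ := exists_geometric_bound_of_mem_genEigenspace
    (M := (algebraMap ℂ _ (c : ℂ) + f) * g) hfg
    (l := l) (μ := (c + l) / (c - l)) (κ := 2 * c / (c - l)) (by
      have h2 : ((c : ℂ) - l) • ((algebraMap ℂ (End ℂ V) (c : ℂ) + f) * g
          - algebraMap ℂ _ ((c + l) / (c - l))) = (2 * c : ℂ) • (g * (f - algebraMap ℂ _ l)) := by
        have h3 : algebraMap ℂ (End ℂ V) ((c + l) / (c - l)) =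
            ((c + l) / (c - l)) • (c • g - f * g) := by
          rw [Algebra.algebraMap_eq_smul_one, ← hg, sub_mul, Algebra.algebraMap_eq_smul_one,
            smul_mul_assoc, one_mul]
          simp
        rw [h3, smul_sub, smul_smul, mul_div_cancel₀ _ hcl, mul_sub, add_mul,
          Algebra.algebraMap_eq_smul_one, Algebra.algebraMap_eq_smul_one, mul_smul_comm,
          smul_mul_assoc, one_mul, mul_one, hfg.eq, ← Complex.coe_smul c g]
        module
      rw [div_eq_inv_mul (2 * (c : ℂ)), ← smul_smul, ← h2, smul_smul,
        inv_mul_cancel₀ hcl, one_smul])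
    (by
      rw [norm_div, div_lt_one (norm_pos_iff.2 hcl), ← sq_lt_sq₀ (norm_nonneg _) (norm_nonneg _),
        ← Complex.normSq_eq_norm_sq,
        ← Complex.normSq_eq_norm_sq, Complex.normSq_apply, Complex.normSq_apply]
      simp
      nlinarith) k x (by
      simpa [Algebra.algebraMap_eq_smul_one] using hk)
  refine squeeze_zero_norm hb ?_
  simpa using (tendsto_pow_atTop_nhds_zero_of_lt_one hs0 hs1).const_mul D

end Orbit

/-- The sum of the generalized eigenspaces whose eigenvalues satisfy `p`. -/
def spectralSubspace {V : Type*} [AddCommGroup V] [Module ℂ V] (f : End ℂ V) (p : ℂ → Prop) :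
    Submodule ℂ V :=
  ⨆ l, ⨆ _ : p l, f.maxGenEigenspace l

/-- The multiplicity of a root is the dimension of its maximal generalized eigenspace, and these
spaces are independent, so dimensions add over the finitely many roots satisfying `p`. -/
theorem countP_roots_charpoly_le_finrank {V : Type*} [AddCommGroup V] [Module ℂ V]
    [FiniteDimensional ℂ V] (f : End ℂ V) (p : ℂ → Prop) [DecidablePred p] :
    f.charpoly.roots.countP p ≤ finrank ℂ (spectralSubspace f p) := by
  classical
  have key (s : Finset ℂ) : ∑ l ∈ s, finrank ℂ (f.maxGenEigenspace l) ≤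
      finrank ℂ (⨆ l ∈ s, f.maxGenEigenspace l : Submodule ℂ V) := by
    induction s using Finset.induction_on with
    | empty => simp
    | insert a s ha ih =>
      rw [Finset.sum_insert ha, Finset.iSup_insert]
      have hd : Disjoint (f.maxGenEigenspace a) (⨆ l ∈ s, f.maxGenEigenspace l) :=
        (f.independent_maxGenEigenspace a).mono_right
          (iSup₂_mono' fun l hl => ⟨l, ne_of_mem_of_not_mem hl ha, le_rfl⟩)
      have := Submodule.finrank_sup_add_finrank_inf_eq (f.maxGenEigenspace a)
        (⨆ l ∈ s, f.maxGenEigenspace l)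
      rw [hd.eq_bot, finrank_bot, add_zero] at this
      rw [this]
      gcongr
  rw [Multiset.countP_eq_card_filter, ← Multiset.toFinset_sum_count_eq]
  refine le_trans (le_of_eq (Finset.sum_congr rfl fun l hl => ?_))
    ((key (f.charpoly.roots.filter p).toFinset).trans (Submodule.finrank_mono ?_))
  · rw [Multiset.mem_toFinset, Multiset.mem_filter] at hl
    rw [Multiset.count_filter_of_pos hl.2, Polynomial.count_roots,
      LinearMap.finrank_maxGenEigenspace_eq]
  · exact iSup₂_mono' fun l hl => ⟨l, by simp at hl; exact hl.2, le_rfl⟩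

/-! ### Lyapunov inequalities and inertia. -/

section Inertia

variable {ι : Type*} [Fintype ι] [DecidableEq ι]

/-- Lyapunov: if `q(x) = x* P x` is nonincreasing along `x' = A x`, it is nonnegative on the stable
subspace of `A`. -/
theorem re_quadraticForm_nonneg_of_mem_spectralSubspace {A P : Matrix ι ι ℂ}
    (h : ∀ y, (star (A *ᵥ y) ⬝ᵥ P *ᵥ y + star y ⬝ᵥ P *ᵥ (A *ᵥ y)).re ≤ 0)
    {x : ι → ℂ} (hx : x ∈ spectralSubspace (toLin' A) (fun s => s.re < 0)) :
    0 ≤ (star x ⬝ᵥ P *ᵥ x).re := by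
  -- The spectrum is finite, so some `c > 0` makes `c - A` invertible. The Cayley transform then
  -- replaces the flow by a discrete iteration.
  obtain ⟨c, hc, hcA⟩ : ∃ c : ℝ, 0 < c ∧ (c : ℂ) ∉ spectrum ℂ (toLin' A) := by
    have hfin : {c : ℝ | (c : ℂ) ∈ spectrum ℂ (toLin' A)}.Finite :=
      (Module.End.finite_spectrum (toLin' A)).preimage Complex.ofReal_injective.injOn
    obtain ⟨c, hc, hc'⟩ := ((Set.Ioi_infinite (0 : ℝ)).sdiff hfin).nonempty
    exact ⟨c, hc, hc'⟩
  obtain ⟨u, hu⟩ := spectrum.notMem_iff.1 hcA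
  set f := toLin' A
  set g : End ℂ (ι → ℂ) := ↑u⁻¹
  have hg : (algebraMap ℂ _ (c : ℂ) - f) * g = 1 := by rw [← hu]; exact u.mul_inv
  have hg' : g * (algebraMap ℂ _ (c : ℂ) - f) = 1 := by rw [← hu]; exact u.inv_mul
  set M := (algebraMap ℂ _ (c : ℂ) + f) * g
  set q : (ι → ℂ) → ℝ := fun x => (star x ⬝ᵥ P *ᵥ x).re
  have hstep (x) : q (M x) ≤ q x := by
    have hx : x = (algebraMap ℂ _ (c : ℂ) - f) (g x) := by
      rw [← Module.End.mul_apply, hg, Module.End.one_apply]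
    have h1 : M x = (c : ℂ) • g x + A *ᵥ g x := by simp [M, f]
    have h2 : x = (c : ℂ) • g x - A *ᵥ g x := by
      conv_lhs => rw [hx]
      simp [f]
    -- With `y = g x` this compares `q` at `c y + A y` and `c y - A y`: only the cross terms
    -- survive, and they are `2c` times the Lyapunov derivative at `y`.
    have h3 : q (M x) - q x =
        2 * c * (star (A *ᵥ g x) ⬝ᵥ P *ᵥ g x + star (g x) ⬝ᵥ P *ᵥ (A *ᵥ g x)).re := by
      simp only [q]
      rw [h1]
      conv_lhs => arg 2; rw [h2]
      simp only [star_add, star_sub, star_smul, Complex.star_def, Complex.conj_ofReal,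
        mulVec_add, mulVec_sub, mulVec_smul, add_dotProduct, sub_dotProduct, dotProduct_add,
        dotProduct_sub, smul_dotProduct, dotProduct_smul, smul_eq_mul, Complex.add_re,
        Complex.sub_re, Complex.re_ofReal_mul]
      ring
    have := mul_nonpos_of_nonneg_of_nonpos (by positivity : 0 ≤ 2 * c) (h (g x))
    linarith
  have hpow (n : ℕ) : q ((M ^ n) x) ≤ q x := by
    induction n with
    | zero => simp
    | succ n ih => rw [pow_succ', Module.End.mul_apply]; exact (hstep _).trans ih
  have hle : spectralSubspace f (fun s => s.re < 0) ≤ vanishingOrbit M :=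
    iSup₂_le fun l hl => maxGenEigenspace_le_vanishingOrbit hc hg hg' hl
  have hq : Continuous q := by
    simp only [q, dotProduct, mulVec]
    fun_prop
  have hlim : Tendsto (fun n => q ((M ^ n) x)) atTop (𝓝 (q 0)) :=
    (hq.tendsto 0).comp (hle hx)
  have hq0 : q 0 = 0 := by simp [q]
  exact hq0 ▸ le_of_tendsto' hlim hpow

/-- Time reversal: the Lyapunov argument for `-A` and `-P` then shows that the form of `P` is
nonpositive on the antistable subspace of `A`. -/
theorem spectralSubspace_neg (A : Matrix ι ι ℂ) :
    spectralSubspace (toLin' A) (fun s => 0 < s.re) ≤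
      spectralSubspace (toLin' (-A)) (fun s => s.re < 0) := by
  refine iSup₂_mono' fun l hl => ⟨-l, by simpa using hl, fun x hx => ?_⟩
  rw [Module.End.mem_maxGenEigenspace] at hx ⊢
  obtain ⟨k, hk⟩ := hx
  refine ⟨k, ?_⟩
  have e : (toLin' (-A) - -l • 1 : End ℂ (ι → ℂ)) ^ k = (-1) ^ k * (toLin' A - l • 1) ^ k := by
    rw [show (toLin' (-A) - -l • 1 : End ℂ (ι → ℂ)) = -(toLin' A - l • 1) by rw [map_neg]; module]
    exact neg_pow (toLin' A - l • 1 : End ℂ (ι → ℂ)) k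
  rw [e, Module.End.mul_apply, hk, map_zero]

/-- Inertia theorem for a quadratic form with one negative square. -/
theorem countP_roots_of_lyapunov {A P : Matrix ι ι ℂ}
    (h : ∀ y, (star (A *ᵥ y) ⬝ᵥ P *ᵥ y + star y ⬝ᵥ P *ᵥ (A *ᵥ y)).re ≤ 0)
    (himag : ∀ s ∈ spectrum ℂ A, s.re ≠ 0)
    (hneg : ∃ v, (star v ⬝ᵥ P *ᵥ v).re < 0)
    (hpos : ∃ u : ι → ℂ, ∀ x, x ≠ 0 → u ⬝ᵥ x = 0 → 0 < (star x ⬝ᵥ P *ᵥ x).re) :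
    A.charpoly.roots.countP (fun s => s.re < 0) + 1 = Fintype.card ι ∧
      A.charpoly.roots.countP (fun s => 0 < s.re) = 1 := by
  have hsum : A.charpoly.roots.countP (fun s => s.re < 0) +
      A.charpoly.roots.countP (fun s => 0 < s.re) = Fintype.card ι := by
    rw [← A.charpoly_natDegree_eq_dim, (IsAlgClosed.splits A.charpoly).natDegree_eq_card_roots,
      Multiset.card_eq_countP_add_countP (fun s : ℂ => s.re < 0)]
    congr 1
    refine Multiset.countP_congr rfl fun s hs => ?_
    have h0 : s.re ≠ 0 := himag s (by
      rw [Matrix.mem_spectrum_iff_isRoot_charpoly]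
      exact Polynomial.isRoot_of_mem_roots hs)
    simp only [not_lt, eq_iff_iff]
    exact ⟨le_of_lt, fun h' => lt_of_le_of_ne h' h0.symm⟩
  -- If the stable subspace were everything, the form would be nonnegative everywhere, contrary to
  -- `hneg`.
  have hm : A.charpoly.roots.countP (fun s => s.re < 0) < Fintype.card ι := by
    have h1 := countP_roots_charpoly_le_finrank (toLin' A) (fun s => s.re < 0)
    rw [Matrix.charpoly_toLin'] at h1
    refine h1.trans_lt ?_
    rw [← Module.finrank_fintype_fun_eq_card ℂ (η := ι)]
    refine Submodule.finrank_lt fun htop => ?_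
    obtain ⟨v, hv⟩ := hneg
    have := re_quadraticForm_nonneg_of_mem_spectralSubspace h (x := v) (htop ▸ Submodule.mem_top)
    linarith
  have hp : A.charpoly.roots.countP (fun s => 0 < s.re) ≤ 1 := by
    have h1 := countP_roots_charpoly_le_finrank (toLin' A) (fun s => 0 < s.re)
    rw [Matrix.charpoly_toLin'] at h1
    refine h1.trans ?_
    obtain ⟨u, hu⟩ := hpos
    set E := spectralSubspace (toLin' A) (fun s => 0 < s.re)
    let φ : E →ₗ[ℂ] ℂ := (dotProductBilin ℂ ℂ u).comp E.subtype
    -- A nonzero antistable vector with `u ⬝ᵥ x = 0` would make the form both positive and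
    -- nonpositive. Hence `u` embeds the antistable subspace in `ℂ`.
    have hφ : Function.Injective φ := by
      rw [← LinearMap.ker_eq_bot, LinearMap.ker_eq_bot']
      rintro ⟨x, hx⟩ h0
      by_contra hne
      have hx0 : x ≠ 0 := fun h' => hne (Subtype.ext h')
      have h2 := hu x hx0 h0
      have h3 := re_quadraticForm_nonneg_of_mem_spectralSubspace (A := -A) (P := -P)
        (fun y => by simpa [neg_mulVec, mulVec_neg] using h y) (spectralSubspace_neg A hx)
      simp [neg_mulVec] at h3
      linarith
    simpa using LinearMap.finrank_le_finrank_of_injective hφ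
  omega

end Inertia

/-! ### The largest singular value as an operator norm. -/

section SingularValues

variable {E F : Type*} [NormedAddCommGroup E] [InnerProductSpace ℂ E] [FiniteDimensional ℂ E]
  [NormedAddCommGroup F] [InnerProductSpace ℂ F] [FiniteDimensional ℂ F] (T : E →ₗ[ℂ] F)

theorem norm_apply_le_singularValues_zero (x : E) : ‖T x‖ ≤ T.singularValues 0 * ‖x‖ := by
  have hS := T.isSymmetric_adjoint_comp_self
  set b := hS.eigenvectorBasis rfl
  refine le_of_sq_le_sq ?_ (mul_nonneg (T.singularValues_nonneg 0) (norm_nonneg x))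
  have h1 : ‖T x‖ ^ 2 = ∑ i, hS.eigenvalues rfl i * ‖b.repr x i‖ ^ 2 := by
    rw [← inner_self_eq_norm_sq (𝕜 := ℂ), ← LinearMap.adjoint_inner_left, ← LinearMap.comp_apply,
      ← b.repr.inner_map_map, PiLp.inner_apply, map_sum]
    refine Finset.sum_congr rfl fun i _ => ?_
    rw [hS.eigenvectorBasis_apply_self_apply rfl x i, ← smul_eq_mul, inner_smul_left,
      inner_self_eq_norm_sq_to_K]
    simp only [Complex.coe_algebraMap, RCLike.re_to_complex, Complex.conj_ofReal]
    norm_cast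
  rw [h1, mul_pow, ← b.repr.norm_map x, EuclideanSpace.norm_sq_eq, Finset.mul_sum]
  refine Finset.sum_le_sum fun i _ => mul_le_mul_of_nonneg_right ?_ (sq_nonneg _)
  rw [← T.sq_singularValues_fin rfl i]
  exact pow_le_pow_left₀ (T.singularValues_nonneg _) (T.singularValues_antitone (Nat.zero_le _)) 2

theorem exists_norm_apply_eq_singularValues_zero [Nontrivial E] :
    ∃ v, v ≠ 0 ∧ ‖T v‖ = T.singularValues 0 * ‖v‖ := by
  obtain ⟨v, hv⟩ := (T.hasEigenvalue_adjoint_comp_self_sq_singularValues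
    (Module.finrank_pos (R := ℂ) (M := E))).exists_hasEigenvector
  refine ⟨v, hv.2, ?_⟩
  rw [← sq_eq_sq₀ (norm_nonneg _) (mul_nonneg (T.singularValues_nonneg 0) (norm_nonneg v)),
    ← inner_self_eq_norm_sq (𝕜 := ℂ), ← LinearMap.adjoint_inner_left, ← LinearMap.comp_apply,
    hv.apply_eq_smul, inner_smul_left, inner_self_eq_norm_sq_to_K, mul_pow]
  simp only [Complex.coe_algebraMap, RCLike.re_to_complex]
  norm_cast
  simp [-Complex.ofReal_mul, -Complex.ofReal_pow]

theorem singularValues_zero_eq_opNorm :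
    T.singularValues 0 = ‖LinearMap.toContinuousLinearMap T‖ := by
  refine le_antisymm ?_ (ContinuousLinearMap.opNorm_le_bound _ (T.singularValues_nonneg 0)
    (norm_apply_le_singularValues_zero T))
  rcases subsingleton_or_nontrivial E with h | h
  · rw [T.singularValues_of_finrank_le (by rw [finrank_zero_of_subsingleton])]
    exact norm_nonneg _
  · obtain ⟨v, hv, hTv⟩ := exists_norm_apply_eq_singularValues_zero T
    refine le_of_mul_le_mul_right ?_ (norm_pos_iff.2 hv)
    rw [← hTv]
    exact (LinearMap.toContinuousLinearMap T).le_opNorm v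

/-- The value is attained at some `v`. With `w = T* T v`, `‖w‖² = Re ⟨T v, T w⟩ ≤ ‖T v‖ ‖w‖`, so
`‖w‖ ≤ ‖T v‖ < ‖v‖`; pointwise strictness therefore suffices. -/
theorem singularValues_zero_adjoint_comp_self_lt_one (hT : ∀ v, v ≠ 0 → ‖T v‖ < ‖v‖) :
    (LinearMap.adjoint T ∘ₗ T).singularValues 0 < 1 := by
  rcases subsingleton_or_nontrivial E with h | h
  · rw [LinearMap.singularValues_of_finrank_le _ (by rw [finrank_zero_of_subsingleton])]
    exact one_pos
  · obtain ⟨v, hv, hTv⟩ := exists_norm_apply_eq_singularValues_zero (LinearMap.adjoint T ∘ₗ T)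
    have hle (w : E) : ‖T w‖ ≤ ‖w‖ := by
      rcases eq_or_ne w 0 with rfl | hw
      · simp
      · exact (hT w hw).le
    set w := (LinearMap.adjoint T ∘ₗ T) v
    have h1 : ‖w‖ * ‖w‖ ≤ ‖w‖ * ‖T v‖ := by
      calc ‖w‖ * ‖w‖ = RCLike.re (inner ℂ w w) := by rw [inner_self_eq_norm_sq, sq]
        _ = RCLike.re (inner ℂ (T v) (T w)) :=
          congrArg RCLike.re (LinearMap.adjoint_inner_left T w (T v))
        _ ≤ ‖T v‖ * ‖T w‖ := re_inner_le_norm _ _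
        _ ≤ ‖T v‖ * ‖w‖ := by gcongr; exact hle w
        _ = ‖w‖ * ‖T v‖ := mul_comm _ _
    have h2 : ‖w‖ < ‖v‖ := by
      rcases eq_or_ne w 0 with hw | hw
      · simpa [hw] using hv
      · exact (le_of_mul_le_mul_left h1 (norm_pos_iff.2 hw)).trans_lt (hT v hv)
    rw [hTv] at h2
    nlinarith [norm_pos_iff.2 hv]

end SingularValues

theorem continuous_sigmaMax {κ ι : Type*} [Fintype κ] [Fintype ι] [DecidableEq ι] :
    Continuous (sigmaMax : Matrix κ ι ℂ → ℝ) := by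
  have h : Continuous ((LinearMap.toContinuousLinearMap (𝕜 := ℂ) (E := EuclideanSpace ℂ ι)
      (F' := EuclideanSpace ℂ κ)).toLinearMap ∘ₗ
        (Matrix.toEuclideanLin (𝕜 := ℂ) (m := κ) (n := ι)).toLinearMap) :=
    LinearMap.continuous_of_finiteDimensional _
  refine h.norm.congr fun M => ?_
  exact (singularValues_zero_eq_opNorm _).symm

/-! ### Real matrices acting on complex vectors. -/

section MapOfReal

variable {ι κ o : Type*}

theorem map_ofReal_mul [Fintype κ] (M : Matrix ι κ ℝ) (N : Matrix κ o ℝ) :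
    (M * N).map Complex.ofReal = M.map Complex.ofReal * N.map Complex.ofReal :=
  Matrix.map_mul (f := Complex.ofRealHom)

theorem map_ofReal_add (M N : Matrix ι κ ℝ) :
    (M + N).map Complex.ofReal = M.map Complex.ofReal + N.map Complex.ofReal :=
  Matrix.map_add _ Complex.ofReal_add M N

theorem conjTranspose_map_ofReal (M : Matrix ι κ ℝ) :
    (M.map Complex.ofReal)ᴴ = Mᵀ.map Complex.ofReal := by
  ext i j
  simp

/-- The system matrices are real and `-iω` is the conjugate of `iω`. This turns the gain into the
largest singular value of `Gᴴ G`. -/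
theorem transpose_transfer_neg [Fintype ι] [DecidableEq ι] (S : LTISystem ι κ o) (ω : ℝ) :
    (S.transfer (-(Complex.I * (ω : ℂ))))ᵀ = (S.transfer (Complex.I * (ω : ℂ)))ᴴ := by
  simp only [LTISystem.transfer, conjTranspose_mul, transpose_mul, conjTranspose_map_ofReal,
    transpose_map, conjTranspose_nonsing_inv, transpose_nonsing_inv, conjTranspose_sub,
    conjTranspose_smul, conjTranspose_one, transpose_sub, transpose_smul, transpose_one]
  simp

/-- The cross terms between real and imaginary parts are purely imaginary. Sign conditions on a real
form thus carry over to complex vectors. -/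
theorem re_star_dotProduct_map_ofReal_mulVec [Fintype ι] (P : Matrix ι ι ℝ) (x : ι → ℂ) :
    (star x ⬝ᵥ P.map Complex.ofReal *ᵥ x).re =
      (fun i => (x i).re) ⬝ᵥ P *ᵥ (fun i => (x i).re) +
        (fun i => (x i).im) ⬝ᵥ P *ᵥ (fun i => (x i).im) := by
  simp only [dotProduct, mulVec, Complex.re_sum, ← Finset.sum_add_distrib]
  refine Finset.sum_congr rfl fun i _ => ?_
  simp [Complex.mul_re, Complex.re_sum, Complex.im_sum]

end MapOfReal

/-! ### The bounded real lemma with an indefinite Riccati solution. -/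

section BoundedReal

variable {ι κ o : Type*} [Fintype ι] [Fintype κ] [Fintype o]

/-- Dissipation identity: if `P` solves the bounded real Riccati equation, then `z* z - w* w +
(w - B* P x)* (w - B* P x)` is the derivative of `-x* P x` along `x' = A x + B w`, `z = C x`. -/
theorem dissipation {A P : Matrix ι ι ℂ} {B : Matrix ι κ ℂ} {C : Matrix o ι ℂ} (hP : Pᴴ = P)
    (hric : Aᴴ * P + P * A + Cᴴ * C + P * B * Bᴴ * P = 0) (x : ι → ℂ) (w : κ → ℂ) :
    star (A *ᵥ x + B *ᵥ w) ⬝ᵥ P *ᵥ x + star x ⬝ᵥ P *ᵥ (A *ᵥ x + B *ᵥ w) +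
      star (C *ᵥ x) ⬝ᵥ (C *ᵥ x) =
    star w ⬝ᵥ w - star (w - Bᴴ *ᵥ P *ᵥ x) ⬝ᵥ (w - Bᴴ *ᵥ P *ᵥ x) := by
  have h := congrArg (fun M => star x ⬝ᵥ M *ᵥ x) hric
  simp only [add_mulVec, dotProduct_add, zero_mulVec, dotProduct_zero, ← mulVec_mulVec] at h
  simp only [star_add, star_sub, star_mulVec, conjTranspose_conjTranspose, hP, add_dotProduct,
    sub_dotProduct, dotProduct_add, dotProduct_sub, mulVec_add, ← dotProduct_mulVec]
  linear_combination h

theorem re_star_dotProduct_self (u : κ → ℂ) : (star u ⬝ᵥ u).re = ‖WithLp.toLp 2 u‖ ^ 2 := by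
  rw [← inner_self_eq_norm_sq (𝕜 := ℂ), EuclideanSpace.inner_toLp_toLp, dotProduct_comm]
  rfl

variable [DecidableEq ι]

theorem exists_mulVec_eq_smul_of_mem_spectrum {A : Matrix ι ι ℂ} {s : ℂ} (hs : s ∈ spectrum ℂ A) :
    ∃ x, x ≠ 0 ∧ A *ᵥ x = s • x := by
  rw [← spectrum_toLin', ← Module.End.hasEigenvalue_iff_mem_spectrum] at hs
  obtain ⟨x, hx⟩ := hs.exists_hasEigenvector
  exact ⟨x, hx.2, by simpa using hx.apply_eq_smul⟩

theorem mem_spectrum_of_mulVec_eq_smul {A : Matrix ι ι ℂ} {s : ℂ} {x : ι → ℂ} (hx : x ≠ 0)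
    (h : A *ᵥ x = s • x) : s ∈ spectrum ℂ A := by
  rw [← spectrum_toLin', ← Module.End.hasEigenvalue_iff_mem_spectrum]
  exact Module.End.hasEigenvalue_of_hasEigenvector (x := x)
    ⟨Module.End.mem_eigenspace_iff.2 (by simpa using h), hx⟩

variable {A P : Matrix ι ι ℂ} {B : Matrix ι κ ℂ} {C : Matrix o ι ℂ}

/-- `A` has no purely imaginary eigenvalue if `A + B B* P` has none. -/
theorem re_ne_zero_of_mem_spectrum (hP : Pᴴ = P)
    (hric : Aᴴ * P + P * A + Cᴴ * C + P * B * Bᴴ * P = 0)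
    (hcl : ∀ s ∈ spectrum ℂ (A + B * Bᴴ * P), s.re ≠ 0) : ∀ s ∈ spectrum ℂ A, s.re ≠ 0 := by
  intro s hs h0
  obtain ⟨x, hx, hAx⟩ := exists_mulVec_eq_smul_of_mem_spectrum hs
  -- For imaginary `s` the two terms in `x* P x` cancel, leaving `‖C x‖² = -‖B* P x‖²`. So `B* P x =
  -- 0`, and `x` is also an eigenvector of `A + B B* P`.
  have h := congrArg Complex.re (dissipation hP hric x 0)
  have hconj : star s = -s := Complex.ext (by simp [h0]) (by simp)
  rw [mulVec_zero, add_zero, hAx, star_smul, mulVec_smul, smul_dotProduct, dotProduct_smul, hconj,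
    neg_smul, neg_add_cancel, zero_add, star_zero, zero_dotProduct, zero_sub, zero_sub,
    Complex.neg_re, re_star_dotProduct_self, re_star_dotProduct_self] at h
  have hB : -Bᴴ *ᵥ P *ᵥ x = 0 := by
    have : ‖WithLp.toLp 2 (-Bᴴ *ᵥ P *ᵥ x)‖ = 0 := by
      rw [neg_mulVec]
      nlinarith [sq_nonneg ‖WithLp.toLp 2 (C *ᵥ x)‖, sq_nonneg ‖WithLp.toLp 2 (-(Bᴴ *ᵥ P *ᵥ x))‖]
    simpa using this
  refine hcl s (mem_spectrum_of_mulVec_eq_smul hx ?_) h0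
  rw [neg_mulVec, neg_eq_zero] at hB
  rw [add_mulVec, Matrix.mul_assoc, ← mulVec_mulVec, ← mulVec_mulVec, hB, mulVec_zero, add_zero,
    hAx]

/-- The transfer matrix of a system with a bounded real Riccati solution is strictly contractive
on the imaginary axis. -/
theorem norm_transfer_lt (hP : Pᴴ = P)
    (hric : Aᴴ * P + P * A + Cᴴ * C + P * B * Bᴴ * P = 0)
    (hcl : ∀ s ∈ spectrum ℂ (A + B * Bᴴ * P), s.re ≠ 0) {s : ℂ} (hs : s.re = 0)
    (hinv : IsUnit (s • (1 : Matrix ι ι ℂ) - A)) (w : κ → ℂ) (hw : w ≠ 0) :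
    ‖WithLp.toLp 2 ((C * (s • (1 : Matrix ι ι ℂ) - A)⁻¹ * B) *ᵥ w)‖ < ‖WithLp.toLp 2 w‖ := by
  set x := (s • (1 : Matrix ι ι ℂ) - A)⁻¹ *ᵥ B *ᵥ w
  have hx : s • x = A *ᵥ x + B *ᵥ w := by
    have : (s • (1 : Matrix ι ι ℂ) - A) *ᵥ x = B *ᵥ w := by
      rw [mulVec_mulVec, mul_nonsing_inv _ ((isUnit_iff_isUnit_det _).1 hinv), one_mulVec]
    rw [← this, sub_mulVec, smul_mulVec, one_mulVec]
    abel
  have hconj : star s = -s := Complex.ext (by simp [hs]) (by simp)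
  have h := congrArg Complex.re (dissipation hP hric x w)
  rw [← hx, star_smul, mulVec_smul, smul_dotProduct, dotProduct_smul, hconj, neg_smul,
    neg_add_cancel, zero_add, Complex.sub_re, re_star_dotProduct_self, re_star_dotProduct_self,
    re_star_dotProduct_self] at h
  rw [← mulVec_mulVec, ← mulVec_mulVec]
  refine lt_of_pow_lt_pow_left₀ 2 (norm_nonneg _) ?_
  rw [h, sub_lt_self_iff]
  -- Equality of the norms would force `w = B* P x`, hence `(A + B B* P) x = s x` with `x ≠ 0`,
  -- which `hcl` excludes.
  refine pow_pos (norm_pos_iff.2 fun h0 => ?_) 2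
  have hwx : w = Bᴴ *ᵥ P *ᵥ x := by simpa [sub_eq_zero] using h0
  have hAx : (A + B * Bᴴ * P) *ᵥ x = s • x := by
    rw [hx, add_mulVec, Matrix.mul_assoc, ← mulVec_mulVec, ← mulVec_mulVec, ← hwx]
  refine hcl s (mem_spectrum_of_mulVec_eq_smul (fun hx0 => hw ?_) hAx) hs
  rw [hwx, hx0, mulVec_zero, mulVec_zero]

theorem inv_eq_det_inv_smul_adjugate (M : Matrix ι ι ℂ) : M⁻¹ = M.det⁻¹ • M.adjugate := by
  rw [inv_def, Ring.inverse_eq_inv']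

theorem continuous_resolvent_imag (hA : ∀ s ∈ spectrum ℂ A, s.re ≠ 0) :
    Continuous fun ω : ℝ => ((Complex.I * ω) • (1 : Matrix ι ι ℂ) - A)⁻¹ := by
  simp only [inv_eq_det_inv_smul_adjugate]
  have h : Continuous fun ω : ℝ => (Complex.I * ω) • (1 : Matrix ι ι ℂ) - A := by fun_prop
  refine (h.matrix_det.inv₀ fun ω h0 => ?_).smul h.matrix_adjugate
  refine hA (Complex.I * ω) ?_ (by simp)
  rw [spectrum.mem_iff, Algebra.algebraMap_eq_smul_one, isUnit_iff_isUnit_det, h0]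
  exact not_isUnit_zero

/-- With `t = 1 / (iω)` the resolvent is `t (1 - t A)⁻¹`, which is continuous at `t = 0` and
vanishes there. -/
theorem tendsto_resolvent_imag (A : Matrix ι ι ℂ) :
    Tendsto (fun ω : ℝ => ((Complex.I * ω) • (1 : Matrix ι ι ℂ) - A)⁻¹) (cocompact ℝ) (𝓝 0) := by
  have h1 : Tendsto (fun ω : ℝ => (Complex.I * ω)⁻¹) (cocompact ℝ) (𝓝 0) := by
    rw [tendsto_zero_iff_norm_tendsto_zero]
    simp only [norm_inv, norm_mul, Complex.norm_I, one_mul, Complex.norm_real]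
    exact tendsto_inv_atTop_zero.comp tendsto_norm_cocompact_atTop
  have h2 : ContinuousAt (fun t : ℂ => t • ((1 : Matrix ι ι ℂ) - t • A)⁻¹) 0 := by
    simp only [inv_eq_det_inv_smul_adjugate]
    have h : Continuous fun t : ℂ => (1 : Matrix ι ι ℂ) - t • A := by fun_prop
    exact continuousAt_id.smul ((h.matrix_det.continuousAt.inv₀ (by simp)).smul
      h.matrix_adjugate.continuousAt)
  have h3 := h2.tendsto.comp h1
  simp only [zero_smul] at h3
  refine h3.congr' ?_
  filter_upwards [(isCompact_singleton (x := (0 : ℝ))).compl_mem_cocompact] with ω hω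
  have h0 : Complex.I * (ω : ℂ) ≠ 0 := mul_ne_zero Complex.I_ne_zero (by simpa using hω)
  have h : (Complex.I * ω) • (1 : Matrix ι ι ℂ) - A =
      (Complex.I * ω) • ((1 : Matrix ι ι ℂ) - (Complex.I * (ω : ℂ))⁻¹ • A) := by
    rw [smul_sub, smul_smul, mul_inv_cancel₀ h0, one_smul]
  rw [Function.comp_apply, h]
  set M := (1 : Matrix ι ι ℂ) - (Complex.I * (ω : ℂ))⁻¹ • A
  by_cases hM : IsUnit M.det
  · have := invertibleOfNonzero h0
    rw [Matrix.inv_smul M _ hM, invOf_eq_inv]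
  -- In the singular case both inverses are zero by convention.
  · have hM' : ¬IsUnit ((Complex.I * (ω : ℂ)) • M).det := by
      simpa [det_smul, h0] using hM
    rw [nonsing_inv_apply_not_isUnit _ hM, nonsing_inv_apply_not_isUnit _ hM', smul_zero]

end BoundedReal

/-- A continuous nonnegative function on the line that vanishes at infinity attains its maximum. -/
theorem exists_isGreatest_range_of_tendsto_zero {f : ℝ → ℝ} (hf : Continuous f) (h0 : ∀ x, 0 ≤ f x)
    (hlim : Tendsto f (cocompact ℝ) (𝓝 0)) : ∃ x, IsGreatest (Set.range f) (f x) := by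
  suffices ∃ x, ∀ y, f y ≤ f x by
    obtain ⟨x, hx⟩ := this
    exact ⟨x, ⟨x, rfl⟩, by rintro _ ⟨y, rfl⟩; exact hx y⟩
  by_cases h : ∃ x, 0 < f x
  · obtain ⟨x, hx⟩ := h
    exact hf.exists_forall_ge' x ((hlim.eventually (gt_mem_nhds hx)).mono fun y hy => hy.le)
  · push Not at h
    exact ⟨0, fun y => (h y).trans (h0 0)⟩

variable {ι κ o : Type*} [Fintype ι] [DecidableEq ι] [Fintype κ] [DecidableEq κ] [Fintype o]

/-- Bounded real lemma for a Riccati solution whose quadratic form has one negative square. -/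
theorem isPseudoStrictBoundedReal_of_riccati (S : LTISystem ι κ o) {P : Matrix ι ι ℝ}
    (hP : P.IsSymm) (hric : S.Aᵀ * P + P * S.A + S.Cᵀ * S.C + P * S.B * S.Bᵀ * P = 0)
    (hcl : ∀ s ∈ spectrum ℂ ((S.A + S.B * S.Bᵀ * P).map Complex.ofReal), s.re ≠ 0)
    (hneg : ∃ v, v ⬝ᵥ P *ᵥ v < 0)
    (hpos : ∃ u : ι → ℝ, ∀ x, x ≠ 0 → u ⬝ᵥ x = 0 → 0 < x ⬝ᵥ P *ᵥ x) :
    S.IsPseudoStrictBoundedReal := by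
  classical
  have hP' : (P.map Complex.ofReal)ᴴ = P.map Complex.ofReal := by
    rw [conjTranspose_map_ofReal, hP.eq]
  have hric' := congrArg (fun M : Matrix ι ι ℝ => M.map Complex.ofReal) hric
  simp only [map_ofReal_add, map_ofReal_mul, ← conjTranspose_map_ofReal] at hric'
  rw [Matrix.map_zero _ Complex.ofReal_zero] at hric'
  simp only [map_ofReal_add, map_ofReal_mul, ← conjTranspose_map_ofReal] at hcl
  have himag := re_ne_zero_of_mem_spectrum hP' hric' hcl
  have hqpos (a : ι → ℝ) (u : ι → ℝ) (hu : ∀ x, x ≠ 0 → u ⬝ᵥ x = 0 → 0 < x ⬝ᵥ P *ᵥ x)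
      (ha : u ⬝ᵥ a = 0) : 0 ≤ a ⬝ᵥ P *ᵥ a := by
    rcases eq_or_ne a 0 with rfl | h
    · simp
    · exact (hu a h ha).le
  refine ⟨countP_roots_of_lyapunov (P := P.map Complex.ofReal) (fun y => ?_) himag ?_ ?_, ?_⟩
  -- With zero input the derivative of `y* P y` is `-‖C y‖² - ‖B* P y‖²`.
  · have h := congrArg Complex.re (dissipation hP' hric' y 0)
    rw [mulVec_zero, add_zero, star_zero, zero_dotProduct, zero_sub, zero_sub, Complex.neg_re,
      Complex.add_re, re_star_dotProduct_self, re_star_dotProduct_self] at h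
    nlinarith [sq_nonneg ‖WithLp.toLp 2 (S.C.map Complex.ofReal *ᵥ y)‖,
      sq_nonneg ‖WithLp.toLp 2 (-((S.B.map Complex.ofReal)ᴴ *ᵥ P.map Complex.ofReal *ᵥ y))‖]
  · obtain ⟨v, hv⟩ := hneg
    refine ⟨fun i => (v i : ℂ), ?_⟩
    rw [re_star_dotProduct_map_ofReal_mulVec]
    simpa [← Pi.zero_def] using hv
  · obtain ⟨u, hu⟩ := hpos
    refine ⟨fun i => (u i : ℂ), fun x hx hux => ?_⟩
    rw [re_star_dotProduct_map_ofReal_mulVec]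
    have hre : u ⬝ᵥ (fun i => (x i).re) = 0 := by
      simpa [dotProduct, Complex.re_sum] using congrArg Complex.re hux
    have him : u ⬝ᵥ (fun i => (x i).im) = 0 := by
      simpa [dotProduct, Complex.im_sum] using congrArg Complex.im hux
    by_cases h : (fun i => (x i).re) = 0
    · have h' : (fun i => (x i).im) ≠ 0 := fun h' => hx (funext fun i =>
        Complex.ext (congrFun h i) (congrFun h' i))
      exact add_pos_of_nonneg_of_pos (hqpos _ u hu hre) (hu _ h' him)
    · exact add_pos_of_pos_of_nonneg (hu _ h hre) (hqpos _ u hu him)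
  · simp only [transpose_transfer_neg]
    have hG : Continuous fun ω : ℝ => S.transfer (Complex.I * ω) := by
      unfold LTISystem.transfer
      exact (continuous_const.matrix_mul (continuous_resolvent_imag himag)).matrix_mul
        continuous_const
    have hG0 : Tendsto (fun ω : ℝ => S.transfer (Complex.I * ω)) (cocompact ℝ) (𝓝 0) := by
      have h : Continuous fun R : Matrix ι ι ℂ =>
          S.C.map Complex.ofReal * R * S.B.map Complex.ofReal := by fun_prop
      have h' := (h.tendsto 0).comp (tendsto_resolvent_imag (S.A.map Complex.ofReal))
      rwa [Matrix.mul_zero, Matrix.zero_mul] at h'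
    have hN : Continuous fun G : Matrix o κ ℂ => sigmaMax (Gᴴ * G) :=
      continuous_sigmaMax.comp (by fun_prop)
    have hlim := (hN.tendsto 0).comp hG0
    have hzero : sigmaMax (0 : Matrix κ κ ℂ) = 0 := by
      rw [sigmaMax, map_zero toEuclideanLin, LinearMap.singularValues_zero, Finsupp.zero_apply]
    rw [Matrix.mul_zero, hzero] at hlim
    obtain ⟨ω, hω⟩ := exists_isGreatest_range_of_tendsto_zero (hN.comp hG)
      (fun ω => LinearMap.singularValues_nonneg _ _) hlim
    refine ⟨_, hω, ?_⟩
    have h1 : ∀ v : EuclideanSpace ℂ κ, v ≠ 0 →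
        ‖toEuclideanLin (S.transfer (Complex.I * ω)) v‖ < ‖v‖ := by
      intro v hv
      refine norm_transfer_lt hP' hric' hcl (s := Complex.I * ω) (by simp) ?_ (WithLp.ofLp v)
        (by simpa using hv)
      by_contra h
      exact himag (Complex.I * ω)
        (by rwa [spectrum.mem_iff, Algebra.algebraMap_eq_smul_one]) (by simp)
    have h2 := singularValues_zero_adjoint_comp_self_lt_one _ h1
    rw [← toEuclideanLin_conjTranspose_eq_adjoint] at h2
    have h3 : toEuclideanLin ((S.transfer (Complex.I * ω))ᴴ * S.transfer (Complex.I * ω)) =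
        toEuclideanLin (S.transfer (Complex.I * ω))ᴴ ∘ₗ
          toEuclideanLin (S.transfer (Complex.I * ω)) :=
      LinearMap.ext fun v => congrArg (WithLp.toLp 2) (mulVec_mulVec _ _ _).symm
    rwa [← h3] at h2

/-! ### Symmetric matrices and the coupling condition. -/

section Symmetric

variable {ι : Type*} [Fintype ι] [DecidableEq ι]

theorem exists_orthogonal_diagonalization {P : Matrix ι ι ℝ} (hP : P.IsHermitian) :
    ∃ O : Matrix ι ι ℝ, O * Oᵀ = 1 ∧ Oᵀ * O = 1 ∧ P = O * diagonal hP.eigenvalues * Oᵀ := by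
  refine ⟨hP.eigenvectorUnitary, ?_, ?_, ?_⟩
  · simpa [star_eq_conjTranspose] using Unitary.coe_mul_star_self hP.eigenvectorUnitary
  · simpa [star_eq_conjTranspose] using Unitary.coe_star_mul_self hP.eigenvectorUnitary
  · conv_lhs => rw [hP.spectral_theorem, Unitary.conjStarAlgAut_apply]
    simp [star_eq_conjTranspose]

/-- A pseudo-positive definite matrix is negative on some vector and positive definite on a
hyperplane. -/
theorem IsPseudoPosDef.exists_neg_and_pos_on_hyperplane {P : Matrix ι ι ℝ} (hP : IsPseudoPosDef P) :
    (∃ v, v ⬝ᵥ P *ᵥ v < 0) ∧ ∃ u : ι → ℝ, ∀ x, x ≠ 0 → u ⬝ᵥ x = 0 → 0 < x ⬝ᵥ P *ᵥ x := by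
  obtain ⟨hsymm, hp, hn⟩ := hP
  have hH : P.IsHermitian := by rw [IsHermitian, conjTranspose_eq_transpose_of_trivial, hsymm.eq]
  rw [hH.roots_charpoly_eq_eigenvalues, Multiset.countP_map] at hp hn
  have hn' : (Finset.univ.filter fun i => hH.eigenvalues i < 0).card = 1 := hn
  have hp' : (Finset.univ.filter fun i => 0 < hH.eigenvalues i).card + 1 = Fintype.card ι := hp
  obtain ⟨O, hO, hO', hPO⟩ := exists_orthogonal_diagonalization hH
  set d := hH.eigenvalues
  obtain ⟨i₀, hi₀⟩ := Finset.card_eq_one.1 hn'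
  have hd₀ : d i₀ < 0 := by
    have h : i₀ ∈ Finset.univ.filter fun i => d i < 0 := by
      rw [hi₀]
      exact Finset.mem_singleton_self i₀
    exact (Finset.mem_filter.1 h).2
  -- The positive and negative indices together already number `Fintype.card ι`, so no eigenvalue is
  -- zero.
  have hd (i : ι) (hi : i ≠ i₀) : 0 < d i := by
    have hdisj : Disjoint (Finset.univ.filter fun i => 0 < d i)
        (Finset.univ.filter fun i => d i < 0) :=
      Finset.disjoint_filter.2 fun i _ h h' => lt_asymm h h'
    have huniv := (Finset.card_eq_iff_eq_univ _).1 ((Finset.card_union_of_disjoint hdisj).trans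
      (by rw [hn', hp']))
    have hmem := huniv ▸ Finset.mem_univ i
    rw [hi₀] at hmem
    simpa [hi] using hmem
  have hq (x : ι → ℝ) : x ⬝ᵥ P *ᵥ x = ∑ i, d i * (Oᵀ *ᵥ x) i ^ 2 := by
    rw [hPO, ← mulVec_mulVec, ← mulVec_mulVec, dotProduct_mulVec, ← mulVec_transpose]
    simp only [dotProduct, mulVec_diagonal]
    exact Finset.sum_congr rfl fun i _ => by ring
  -- The eigenvector of the negative eigenvalue serves both as the negative vector and as the normal
  -- of the hyperplane.
  refine ⟨⟨O *ᵥ Pi.single i₀ 1, ?_⟩, O *ᵥ Pi.single i₀ 1, fun x hx hux => ?_⟩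
  · rw [hq, mulVec_mulVec, hO', one_mulVec]
    simpa [Pi.single_apply] using hd₀
  · have hx₀ : (Oᵀ *ᵥ x) i₀ = 0 := by
      rw [dotProduct_comm, dotProduct_mulVec, ← mulVec_transpose] at hux
      simpa using hux
    have hOx : Oᵀ *ᵥ x ≠ 0 := fun h => hx (by
      rw [← one_mulVec x, ← hO, ← mulVec_mulVec, h, mulVec_zero])
    obtain ⟨j, hj⟩ := Function.ne_iff.1 hOx
    rw [hq]
    refine Finset.sum_pos' (fun i _ => ?_) ⟨j, Finset.mem_univ j, ?_⟩
    · rcases eq_or_ne i i₀ with rfl | hi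
      · simp [hx₀]
      · exact mul_nonneg (hd i hi).le (sq_nonneg _)
    · have hj₀ : j ≠ i₀ := fun h => hj (by rw [h, hx₀, Pi.zero_apply])
      exact mul_pos (hd j hj₀) (sq_pos_of_ne_zero hj)

theorem ofReal_mem_spectrum_map {M : Matrix ι ι ℝ} {r : ℝ} (hr : r ∈ spectrum ℝ M) :
    (r : ℂ) ∈ spectrum ℂ (M.map Complex.ofReal) := by
  rw [mem_spectrum_iff_isRoot_charpoly] at hr ⊢
  have h : (M.map Complex.ofReal).charpoly = M.charpoly.map Complex.ofRealHom :=
    M.charpoly_map Complex.ofRealHom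
  rw [h]
  exact hr.map (f := Complex.ofRealHom)

/-- Write `Y = R Rᵀ`. The symmetric matrix `Rᵀ X R` has the same nonzero eigenvalues as `X Y`, hence
all are below one and `1 - Rᵀ X R` is positive definite. Congruence by `R⁻¹` turns it into `Y⁻¹ -
X`. -/
theorem posDef_inv_sub_of_specRadius_lt_one {X Y : Matrix ι ι ℝ} (hX : X.IsSymm) (hY : Y.PosDef)
    (hXY : specRadius (X * Y) < 1) : (Y⁻¹ - X).PosDef := by
  obtain ⟨O, hO, hO', hYO⟩ := exists_orthogonal_diagonalization hY.1
  set d := hY.1.eigenvalues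
  set R := O * diagonal (fun i => √(d i))
  have hdd : diagonal (fun i => √(d i)) * diagonal (fun i => √(d i)) = diagonal d := by
    rw [diagonal_mul_diagonal]
    exact congrArg _ (funext fun i => Real.mul_self_sqrt (hY.eigenvalues_pos i).le)
  have hYR : Y = R * Rᵀ := by
    rw [hYO, ← hdd, transpose_mul, diagonal_transpose]
    simp only [R, Matrix.mul_assoc]
  have hR : IsUnit R := by
    have : IsUnit (R * Rᵀ) := hYR ▸ hY.isUnit
    rw [isUnit_iff_isUnit_det, det_mul] at this
    rw [isUnit_iff_isUnit_det]
    exact isUnit_of_mul_isUnit_left this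
  have hRdet := (isUnit_iff_isUnit_det _).1 hR
  have hRtdet : IsUnit Rᵀ.det := by rwa [det_transpose]
  have hH : (1 - Rᵀ * (X * R)).IsHermitian := by
    rw [IsHermitian, conjTranspose_eq_transpose_of_trivial]
    simp [transpose_mul, hX.eq, Matrix.mul_assoc]
  have hpos : (1 - Rᵀ * (X * R)).PosDef := by
    rw [hH.posDef_iff_eigenvalues_pos]
    intro i
    by_contra! hi
    have h1 := hH.eigenvalues_mem_spectrum_real i
    set μ := hH.eigenvalues i
    have h2 : 1 - μ ∈ spectrum ℝ (Rᵀ * (X * R)) := by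
      rw [spectrum.mem_iff] at h1 ⊢
      intro h
      refine h1 ?_
      rw [← IsUnit.neg_iff]
      convert h using 1
      simp only [map_sub, map_one]
      abel
    have h3 : 1 - μ ∈ spectrum ℝ (X * Y) := by
      have h4 : 1 - μ ∈ spectrum ℝ (Rᵀ * (X * R)) \ {0} :=
        ⟨h2, by rw [Set.mem_singleton_iff]; linarith⟩
      rw [spectrum.nonzero_mul_comm, Matrix.mul_assoc, ← hYR] at h4
      exact h4.1
    have h5 : (‖((1 - μ : ℝ) : ℂ)‖₊ : ENNReal) ≤ specRadius (X * Y) :=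
      le_iSup₂ (f := fun (k : ℂ) (_ : k ∈ spectrum ℂ ((X * Y).map Complex.ofReal)) =>
        (‖k‖₊ : ENNReal)) _ (ofReal_mem_spectrum_map h3)
    have h6 := h5.trans_lt hXY
    rw [ENNReal.coe_lt_one_iff, ← NNReal.coe_lt_one, coe_nnnorm, Complex.norm_real,
      Real.norm_eq_abs] at h6
    linarith [le_abs_self (1 - μ)]
  have hfin := hpos.conjTranspose_mul_mul_same (B := R⁻¹)
    (mulVec_injective_of_isUnit ((isUnit_nonsing_inv_iff).2 hR))
  have hYinv : Y⁻¹ = Rᵀ⁻¹ * R⁻¹ := by rw [hYR, Matrix.mul_inv_rev]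
  convert hfin using 1
  rw [hYinv, conjTranspose_eq_transpose_of_trivial, transpose_nonsing_inv, Matrix.mul_sub,
    Matrix.sub_mul,
    Matrix.mul_one]
  congr 1
  rw [← Matrix.mul_assoc Rᵀ⁻¹, nonsing_inv_mul _ hRtdet, Matrix.one_mul, Matrix.mul_assoc,
    mul_nonsing_inv _ hRdet, Matrix.mul_one]

end Symmetric

/-! ### Algebra of the control, filter and closed-loop Riccati equations. -/

section Riccati

variable {n m q p : Type*} [Fintype n] [Fintype m] [Fintype q] [Fintype p]
  {A X Y V : Matrix n n ℝ} {B₁ : Matrix n m ℝ} {B₂ : Matrix n q ℝ} {C₁ : Matrix m n ℝ}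
  {C₂ : Matrix p n ℝ} {D : Matrix m q ℝ} {D' : Matrix p m ℝ} {E₁ : Matrix q q ℝ}
  {E₂ : Matrix p p ℝ} {F : Matrix q n ℝ} {L K : Matrix n p ℝ}

/-- The control Riccati equation written with the feedback gain `F`. -/
theorem control_riccati_gain [DecidableEq m] [DecidableEq q] (hX : Xᵀ = X) (hE : E₁ᵀ = E₁)
    (hdet : IsUnit E₁.det) (hF : F = -(E₁⁻¹ * (B₂ᵀ * X + Dᵀ * C₁)))
    (h : (A - B₂ * E₁⁻¹ * Dᵀ * C₁)ᵀ * X + X * (A - B₂ * E₁⁻¹ * Dᵀ * C₁) +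
      X * (B₁ * B₁ᵀ - B₂ * E₁⁻¹ * B₂ᵀ) * X + C₁ᵀ * (1 - D * E₁⁻¹ * Dᵀ) * C₁ = 0) :
    Aᵀ * X + X * A + X * B₁ * B₁ᵀ * X + C₁ᵀ * C₁ - Fᵀ * E₁ * F = 0 := by
  have hEi : E₁⁻¹ᵀ = E₁⁻¹ := by rw [transpose_nonsing_inv, hE]
  have hcancel (Z : Matrix q n ℝ) : E₁ * (E₁⁻¹ * Z) = Z := by
    rw [← Matrix.mul_assoc, mul_nonsing_inv _ hdet, Matrix.one_mul]
  subst hF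
  rw [← h]
  simp only [Matrix.mul_add, Matrix.add_mul, Matrix.mul_sub, Matrix.sub_mul, Matrix.mul_neg,
    Matrix.neg_mul, Matrix.mul_assoc, transpose_add, transpose_sub, transpose_mul, transpose_neg,
    transpose_transpose, Matrix.one_mul, hX, hEi, hcancel]
  abel

/-- The filter Riccati equation in terms of `V = Y⁻¹` and the weighted gain `K = V L`. -/
theorem filter_riccati_inverse [DecidableEq n] [DecidableEq m] [DecidableEq p]
    (hVt : Vᵀ = V) (hYV : Y * V = 1) (hVY : V * Y = 1)
    (hYt : Yᵀ = Y) (hE : E₂ᵀ = E₂) (hdet : IsUnit E₂.det)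
    (hK : K = V * ((Y * C₂ᵀ + B₁ * D'ᵀ) * E₂⁻¹))
    (h : (A - B₁ * D'ᵀ * E₂⁻¹ * C₂) * Y + Y * (A - B₁ * D'ᵀ * E₂⁻¹ * C₂)ᵀ +
      Y * (C₁ᵀ * C₁ - C₂ᵀ * E₂⁻¹ * C₂) * Y + B₁ * (1 - D'ᵀ * E₂⁻¹ * D') * B₁ᵀ = 0) :
    V * A + Aᵀ * V + C₁ᵀ * C₁ + V * B₁ * B₁ᵀ * V - K * E₂ * Kᵀ = 0 ∧
      K * E₂ = C₂ᵀ + V * B₁ * D'ᵀ := by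
  have hEi : E₂⁻¹ᵀ = E₂⁻¹ := by rw [transpose_nonsing_inv, hE]
  have hcancel (Z : Matrix p n ℝ) : E₂⁻¹ * (E₂ * Z) = Z := by
    rw [← Matrix.mul_assoc, nonsing_inv_mul _ hdet, Matrix.one_mul]
  have hVYn (Z : Matrix n n ℝ) : V * (Y * Z) = Z := by
    rw [← Matrix.mul_assoc, hVY, Matrix.one_mul]
  have hVYp (Z : Matrix n p ℝ) : V * (Y * Z) = Z := by
    rw [← Matrix.mul_assoc, hVY, Matrix.one_mul]
  subst hK
  constructor
  -- Multiplying by `V = Y⁻¹` on both sides exchanges the quadratic and constant terms.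
  · have h' := congrArg (fun M => V * M * V) h
    simp only [Matrix.mul_zero, Matrix.zero_mul] at h'
    rw [← h']
    simp only [Matrix.mul_add, Matrix.add_mul, Matrix.mul_sub, Matrix.sub_mul,
      Matrix.mul_assoc, transpose_add, transpose_sub, transpose_mul,
      transpose_transpose, Matrix.mul_one, hVt, hYt, hEi, hcancel, hVYn, hYV]
    abel
  · rw [Matrix.mul_assoc, Matrix.mul_assoc, nonsing_inv_mul _ hdet, Matrix.mul_one, Matrix.mul_add,
      hVYp, Matrix.mul_assoc]

theorem closed_loop_riccati_state (hX : Xᵀ = X) (hE : E₁ = Dᵀ * D)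
    (hEF : E₁ * F = -(B₂ᵀ * X + Dᵀ * C₁))
    (h : Aᵀ * X + X * A + X * B₁ * B₁ᵀ * X + C₁ᵀ * C₁ - Fᵀ * E₁ * F = 0) :
    (A + B₂ * F)ᵀ * X + X * (A + B₂ * F) + (C₁ + D * F)ᵀ * (C₁ + D * F) +
      X * B₁ * B₁ᵀ * X = 0 := by
  have h1 := congrArg (fun M => Fᵀ * M) hEF
  have h2 := congrArg transpose h1
  subst hE
  simp only [Matrix.mul_add, Matrix.add_mul, Matrix.mul_neg, Matrix.mul_assoc, transpose_add,
    transpose_mul, transpose_neg, transpose_transpose, hX] at h h1 h2 ⊢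
  linear_combination (norm := abel) h + h1 + h2

/-- This is the stationarity condition defining the gain `F`, transposed and multiplied by `F`. It
kills the off-diagonal blocks of the closed-loop equation. -/
theorem closed_loop_riccati_cross (hX : Xᵀ = X) (hE : E₁ = Dᵀ * D)
    (hEF : E₁ * F = -(B₂ᵀ * X + Dᵀ * C₁)) :
    X * (B₂ * F) + (C₁ + D * F)ᵀ * (D * F) = 0 := by
  have h1 := congrArg (fun M => Mᵀ * F) hEF
  subst hE
  simp only [Matrix.add_mul, Matrix.neg_mul, Matrix.mul_assoc, transpose_add,
    transpose_mul, transpose_neg, transpose_transpose, hX] at h1 ⊢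
  linear_combination (norm := abel) h1

/-- The error part of the closed-loop Riccati equation, with `Γ = W Be`. -/
theorem closed_loop_riccati_error (hX : Xᵀ = X) (hV : Vᵀ = V) (hE : E₂ = D' * D'ᵀ)
    (h₁ : V * A + Aᵀ * V + C₁ᵀ * C₁ + V * B₁ * B₁ᵀ * V - K * E₂ * Kᵀ = 0)
    (h₂ : K * E₂ = C₂ᵀ + V * B₁ * D'ᵀ)
    (h₃ : Aᵀ * X + X * A + X * B₁ * B₁ᵀ * X + C₁ᵀ * C₁ - Fᵀ * E₁ * F = 0)
    {M : Matrix n n ℝ} {Γ : Matrix n m ℝ} (hΓ : Γ = (V - X) * B₁ - K * D')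
    (hM : M = (V - X) * A - K * C₂ + Γ * B₁ᵀ * X) :
    Mᵀ + M + Fᵀ * E₁ * F + Γ * Γᵀ = 0 := by
  have h4 := congrArg (fun M => M * Kᵀ) h₂
  have h5 := congrArg transpose h4
  subst hE hM hΓ
  simp only [Matrix.add_mul, Matrix.mul_sub, Matrix.sub_mul, Matrix.mul_assoc,
    transpose_add, transpose_sub, transpose_mul, transpose_transpose, hX, hV] at h₁ h₃ h4 h5 ⊢
  -- The filter equation minus the control equation; `h4` and `h5` account for the terms in `K`.
  linear_combination (norm := abel) h₁ - h₃ + h4 + h5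

/-- With `Γ = W Be`, the left side is `W` times the error block of `A + B Bᵀ P`. Cancelling `W = V -
X` leaves a matrix that depends on the filter data alone. -/
theorem closed_loop_error_matrix (hX : Xᵀ = X) (hV : Vᵀ = V) (hE : E₂ = D' * D'ᵀ)
    (h₂ : K * E₂ = C₂ᵀ + V * B₁ * D'ᵀ)
    {M : Matrix n n ℝ} {Γ : Matrix n m ℝ} (hΓ : Γ = (V - X) * B₁ - K * D')
    (hM : M = (V - X) * A - K * C₂ + Γ * B₁ᵀ * X) :
    M + Γ * Γᵀ = (V - X) * (A + B₁ * B₁ᵀ * V - B₁ * D'ᵀ * Kᵀ) := by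
  have h5 := congrArg transpose (congrArg (fun M => M * Kᵀ) h₂)
  subst hE hM hΓ
  simp only [Matrix.mul_add, Matrix.add_mul, Matrix.mul_sub, Matrix.sub_mul, Matrix.mul_assoc,
    transpose_add, transpose_sub, transpose_mul, transpose_transpose, hX, hV] at h5 ⊢
  linear_combination (norm := abel) h5

/-- Conjugation by `V = Y⁻¹` takes the error block to minus the transposed filter matrix, so a
stabilizing `Y` makes this block antistable. -/
theorem filter_matrix_similar [DecidableEq n] [DecidableEq p] (hV : Vᵀ = V) (hYV : Y * V = 1)
    (hYt : Yᵀ = Y) (hE : E₂ᵀ = E₂)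
    (hK : K = V * ((Y * C₂ᵀ + B₁ * D'ᵀ) * E₂⁻¹))
    (h₁ : V * A + Aᵀ * V + C₁ᵀ * C₁ + V * B₁ * B₁ᵀ * V - K * E₂ * Kᵀ = 0)
    (h₂ : K * E₂ = C₂ᵀ + V * B₁ * D'ᵀ) :
    V * (A + B₁ * B₁ᵀ * V - B₁ * D'ᵀ * Kᵀ) =
      -(((A - B₁ * D'ᵀ * E₂⁻¹ * C₂)ᵀ + (C₁ᵀ * C₁ - C₂ᵀ * E₂⁻¹ * C₂) * Y) * V) := by
  have hEi : E₂⁻¹ᵀ = E₂⁻¹ := by rw [transpose_nonsing_inv, hE]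
  have h4 := congrArg (fun M => M * Kᵀ) h₂
  have hK' : C₂ᵀ * (E₂⁻¹ * (D' * (B₁ᵀ * V))) + C₂ᵀ * (E₂⁻¹ * C₂) = C₂ᵀ * Kᵀ := by
    subst hK
    simp only [Matrix.mul_add, Matrix.add_mul, Matrix.mul_assoc, transpose_add, transpose_mul,
      transpose_transpose, hV, hYt, hEi, hYV, Matrix.mul_one]
    abel
  simp only [Matrix.mul_add, Matrix.add_mul, Matrix.mul_sub, Matrix.sub_mul, Matrix.mul_assoc,
    transpose_sub, transpose_mul, transpose_transpose, hEi, hYV, Matrix.mul_one] at h₁ h4 ⊢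
  linear_combination (norm := abel) h₁ + h4 - hK'

end Riccati

/-! ### Change of coordinates and spectrum of the closed loop. -/

theorem spectrum_conj_involution {ι : Type*} [Fintype ι] [DecidableEq ι] {T M : Matrix ι ι ℝ}
    (hT : T * T = 1) :
    spectrum ℂ ((T * M * T).map Complex.ofReal) = spectrum ℂ (M.map Complex.ofReal) := by
  have h (N : Matrix ι ι ℝ) : (N.map Complex.ofReal).charpoly = N.charpoly.map Complex.ofRealHom :=
    N.charpoly_map Complex.ofRealHom
  ext s
  rw [mem_spectrum_iff_isRoot_charpoly, mem_spectrum_iff_isRoot_charpoly, h, h, Matrix.mul_assoc,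
    charpoly_mul_comm, Matrix.mul_assoc, hT, Matrix.mul_one]

/-- The bounded real lemma in the coordinates `T x`, for an involution `T`. -/
theorem isPseudoStrictBoundedReal_of_riccati_conj {ι κ o : Type*} [Fintype ι] [DecidableEq ι]
    [Fintype κ] [DecidableEq κ] [Fintype o] {S S' : LTISystem ι κ o} {T P : Matrix ι ι ℝ}
    (hT : T * T = 1) (hA : S.A = T * S'.A * T) (hB : S.B = T * S'.B) (hC : S.C = S'.C * T)
    (hP : P.IsSymm)
    (hric : S'.Aᵀ * P + P * S'.A + S'.Cᵀ * S'.C + P * S'.B * S'.Bᵀ * P = 0)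
    (hcl : ∀ s ∈ spectrum ℂ ((S'.A + S'.B * S'.Bᵀ * P).map Complex.ofReal), s.re ≠ 0)
    (hneg : ∃ v, v ⬝ᵥ P *ᵥ v < 0)
    (hpos : ∃ u : ι → ℝ, ∀ x, x ≠ 0 → u ⬝ᵥ x = 0 → 0 < x ⬝ᵥ P *ᵥ x) :
    S.IsPseudoStrictBoundedReal := by
  have hT' : Tᵀ * Tᵀ = 1 := by rw [← transpose_mul, hT, transpose_one]
  have hTi (Z : Matrix ι ι ℝ) : T * (T * Z) = Z := by
    rw [← Matrix.mul_assoc, hT, Matrix.one_mul]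
  have hTi' (Z : Matrix ι ι ℝ) : Tᵀ * (Tᵀ * Z) = Z := by
    rw [← Matrix.mul_assoc, hT', Matrix.one_mul]
  have hTκ (Z : Matrix ι κ ℝ) : T * (T * Z) = Z := by
    rw [← Matrix.mul_assoc, hT, Matrix.one_mul]
  have hq (x : ι → ℝ) : x ⬝ᵥ (Tᵀ * P * T) *ᵥ x = (T *ᵥ x) ⬝ᵥ P *ᵥ (T *ᵥ x) := by
    rw [← mulVec_mulVec, ← mulVec_mulVec, dotProduct_mulVec, ← mulVec_transpose,
      transpose_transpose]
  have hTT (x : ι → ℝ) : T *ᵥ T *ᵥ x = x := by rw [mulVec_mulVec, hT, one_mulVec]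
  refine isPseudoStrictBoundedReal_of_riccati S (P := Tᵀ * P * T) ?_ ?_ ?_ ?_ ?_
  · rw [IsSymm]
    simp only [transpose_mul, transpose_transpose, hP.eq, Matrix.mul_assoc]
  · have h := congrArg (fun M => Tᵀ * M * T) hric
    simp only [Matrix.mul_zero, Matrix.zero_mul] at h
    rw [← h, hA, hB, hC]
    simp only [transpose_mul, Matrix.mul_add, Matrix.add_mul, Matrix.mul_assoc, hTi, hTi', hTκ]
  · have h : S.A + S.B * S.Bᵀ * (Tᵀ * P * T) = T * (S'.A + S'.B * S'.Bᵀ * P) * T := by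
      rw [hA, hB]
      simp only [transpose_mul, Matrix.mul_add, Matrix.add_mul, Matrix.mul_assoc, hTi']
    rwa [h, spectrum_conj_involution hT]
  · obtain ⟨v, hv⟩ := hneg
    exact ⟨T *ᵥ v, by rwa [hq, hTT]⟩
  · obtain ⟨u, hu⟩ := hpos
    refine ⟨Tᵀ *ᵥ u, fun x hx hux => ?_⟩
    rw [hq]
    refine hu _ (fun h => hx ?_) ?_
    · rw [← hTT x, h, mulVec_zero]
    · rw [mulVec_transpose, ← dotProduct_mulVec] at hux
      exact hux

/-- A block upper triangular matrix has no imaginary eigenvalue if one diagonal block is Hurwitz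
and the other is similar to the negative of a Hurwitz matrix. -/
theorem re_ne_zero_of_mem_spectrum_fromBlocks {n : Type*} [Fintype n] [DecidableEq n]
    {M₁ M₂ H N Y V : Matrix n n ℝ} (hM₁ : IsHurwitz M₁) (hN : IsHurwitz N) (hVY : V * Y = 1)
    (hH : V * H = -(N * V)) :
    ∀ s ∈ spectrum ℂ ((fromBlocks M₁ M₂ 0 H).map Complex.ofReal), s.re ≠ 0 := by
  have hmap (ι : Type _) [Fintype ι] [DecidableEq ι] (N : Matrix ι ι ℝ) :
      (N.map Complex.ofReal).charpoly = N.charpoly.map Complex.ofRealHom :=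
    N.charpoly_map Complex.ofRealHom
  have hYV : Y * V = 1 := mul_eq_one_comm.1 hVY
  have hHN : H.charpoly = (-N).charpoly := by
    have : H = Y * (-N * V) := by
      rw [Matrix.neg_mul, ← hH, ← Matrix.mul_assoc, hYV, Matrix.one_mul]
    rw [this, charpoly_mul_comm, Matrix.mul_assoc, hVY, Matrix.mul_one]
  intro s hs
  rw [mem_spectrum_iff_isRoot_charpoly, fromBlocks_map, Matrix.map_zero _ Complex.ofReal_zero,
    charpoly_fromBlocks_zero₂₁, Polynomial.root_mul, ← mem_spectrum_iff_isRoot_charpoly] at hs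
  rcases hs with hs | hs
  · exact (hM₁ s hs).ne
  · rw [hmap, hHN, ← hmap, ← mem_spectrum_iff_isRoot_charpoly,
      show (-N).map Complex.ofReal = -N.map Complex.ofReal by ext; simp, ← spectrum.neg_eq,
      Set.mem_neg] at hs
    have := hN _ hs
    rw [Complex.neg_re] at this
    linarith

theorem dotProduct_fromBlocks_diagonal {n : Type*} [Fintype n] (X W : Matrix n n ℝ)
    (x : n ⊕ n → ℝ) :
    x ⬝ᵥ fromBlocks X 0 0 W *ᵥ x =
      (x ∘ Sum.inl) ⬝ᵥ X *ᵥ (x ∘ Sum.inl) + (x ∘ Sum.inr) ⬝ᵥ W *ᵥ (x ∘ Sum.inr) := by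
  rw [fromBlocks_mulVec, zero_mulVec, zero_mulVec, add_zero, zero_add]
  simp [dotProduct, Fintype.sum_sum_type]

/-! ### Assembly for the central compensator. -/

/-- The central compensator makes the closed loop pseudo strict bounded real. -/
theorem Plant.exists_compensator_isPseudoStrictBoundedReal (n m q p : ℕ) (S : Plant n m q p)
    (hE₁ : S.E₁.PosDef) (hE₂ : S.E₂.PosDef)
    (X Y : Matrix (Fin n) (Fin n) ℝ)
    (hX : S.IsStabilizingX X) (hXpd : IsPseudoPosDef X)
    (hY : S.IsStabilizingY Y) (hYpd : Y.PosDef)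
    (hXY : specRadius (X * Y) < 1) :
    IsUnit (1 - Y * X) ∧
      ∃ K : Compensator n q p,
        K.Cc = -(S.E₁⁻¹ * (S.B₂ᵀ * X + S.D₁₂ᵀ * S.C₁)) ∧
        K.Bc = (1 - Y * X)⁻¹ * (Y * S.C₂ᵀ + S.B₁ * S.D₂₁ᵀ) * S.E₂⁻¹ ∧
        K.Ac = S.A + S.B₂ * K.Cc - K.Bc * S.C₂ + (S.B₁ - K.Bc * S.D₂₁) * S.B₁ᵀ * X ∧
        (S.closedLoop K).IsPseudoStrictBoundedReal := by
  obtain ⟨hXt, hXric, hXstab⟩ := hX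
  obtain ⟨hYt, hYric, hYstab⟩ := hY
  have hYdet := (isUnit_iff_isUnit_det _).1 hYpd.isUnit
  have hE₁det := (isUnit_iff_isUnit_det _).1 hE₁.isUnit
  have hE₂det := (isUnit_iff_isUnit_det _).1 hE₂.isUnit
  have hWpd := posDef_inv_sub_of_specRadius_lt_one hXt hYpd hXY
  have hE₁t : S.E₁ᵀ = S.E₁ := by rw [Plant.E₁, transpose_mul, transpose_transpose]
  have hE₂t : S.E₂ᵀ = S.E₂ := by rw [Plant.E₂, transpose_mul, transpose_transpose]
  have hVt : Y⁻¹ᵀ = Y⁻¹ := by rw [transpose_nonsing_inv, hYt.eq]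
  have hYV : Y * Y⁻¹ = 1 := mul_nonsing_inv _ hYdet
  have hVY : Y⁻¹ * Y = 1 := nonsing_inv_mul _ hYdet
  set V := Y⁻¹
  have hfac : 1 - Y * X = Y * (V - X) := by rw [Matrix.mul_sub, hYV]
  have hunit : IsUnit (1 - Y * X) := by
    rw [hfac]
    exact hYpd.isUnit.mul hWpd.isUnit
  refine ⟨hunit, ?_⟩
  set F := -(S.E₁⁻¹ * (S.B₂ᵀ * X + S.D₁₂ᵀ * S.C₁)) with hF
  set Bc := (1 - Y * X)⁻¹ * (Y * S.C₂ᵀ + S.B₁ * S.D₂₁ᵀ) * S.E₂⁻¹ with hBc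
  refine ⟨⟨S.A + S.B₂ * F - Bc * S.C₂ + (S.B₁ - Bc * S.D₂₁) * S.B₁ᵀ * X, Bc, F⟩, rfl, rfl, rfl, ?_⟩
  -- The factor `(1 - Y X)⁻¹` in the gain is there so that weighting by `W = V - X` gives `V` times
  -- the filter gain, with `X` eliminated.
  have hWBc : (V - X) * Bc = V * ((Y * S.C₂ᵀ + S.B₁ * S.D₂₁ᵀ) * S.E₂⁻¹) := by
    have h : V - X = V * (1 - Y * X) := by
      rw [hfac, ← Matrix.mul_assoc, hVY, Matrix.one_mul]
    rw [h, hBc, Matrix.mul_assoc, Matrix.mul_assoc, ← Matrix.mul_assoc (1 - Y * X),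
      mul_nonsing_inv _ ((isUnit_iff_isUnit_det _).1 hunit), Matrix.one_mul]
  set Be := S.B₁ - Bc * S.D₂₁ with hBe
  set W := V - X with hW
  have hWt : Wᵀ = W := by rw [hW, transpose_sub, hVt, hXt.eq]
  have hΓ : W * Be = (V - X) * S.B₁ - W * Bc * S.D₂₁ := by
    rw [hBe, Matrix.mul_sub, ← Matrix.mul_assoc W]
  have hM : W * (S.A - Bc * S.C₂ + Be * S.B₁ᵀ * X) =
      (V - X) * S.A - W * Bc * S.C₂ + W * Be * S.B₁ᵀ * X := by
    simp only [Matrix.mul_add, Matrix.mul_sub, Matrix.mul_assoc, hW]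
  set Ae := S.A - Bc * S.C₂ + Be * S.B₁ᵀ * X with hAe
  have hEF : S.E₁ * F = -(S.B₂ᵀ * X + S.D₁₂ᵀ * S.C₁) := by
    rw [hF, Matrix.mul_neg, ← Matrix.mul_assoc, mul_nonsing_inv _ hE₁det, Matrix.one_mul]
  have hXF := control_riccati_gain hXt.eq hE₁t hE₁det hF hXric
  rw [transpose_transpose] at hYric
  obtain ⟨hV₁, hV₂⟩ := filter_riccati_inverse hVt hYV hVY hYt.eq hE₂t hE₂det hWBc hYric
  have hWric := closed_loop_riccati_error hXt.eq hVt rfl hV₁ hV₂ hXF hΓ hM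
  have hHW := closed_loop_error_matrix hXt.eq hVt rfl hV₂ hΓ hM
  have hsim := filter_matrix_similar hVt hYV hYt.eq hE₂t hWBc hV₁ hV₂
  have hcross := closed_loop_riccati_cross hXt.eq rfl hEF
  have hstate := closed_loop_riccati_state hXt.eq rfl hEF hXF
  have hWinj : ∀ M N : Matrix (Fin n) (Fin n) ℝ, W * M = W * N → M = N :=
    fun M N h => hWpd.isUnit.mul_left_cancel h
  have hHeq : Ae + Be * Beᵀ * W = S.A + S.B₁ * S.B₁ᵀ * V - S.B₁ * S.D₂₁ᵀ * (W * Bc)ᵀ := by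
    refine hWinj _ _ ?_
    rw [← hHW, Matrix.mul_add, transpose_mul, hWt]
    simp only [Matrix.mul_assoc]
  rw [← hHeq] at hsim
  -- `T` maps `(x, x_c)` to `(x, x - x_c)`. The compensator contains the term `Be B₁ᵀ X x_c`, so the
  -- error is driven by `w - B₁ᵀ X x` and evolves with matrix `Ae`.
  refine isPseudoStrictBoundedReal_of_riccati_conj (T := fromBlocks 1 0 1 (-1))
    (P := fromBlocks X 0 0 W)
    (S' := ⟨fromBlocks (S.A + S.B₂ * F) (-(S.B₂ * F)) (-(Be * S.B₁ᵀ * X)) Ae, fromRows S.B₁ Be,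
      fromCols (S.C₁ + S.D₁₂ * F) (-(S.D₁₂ * F))⟩) ?_ ?_ ?_ ?_ ?_ ?_ ?_ ?_ ?_
  · simp [fromBlocks_multiply]
  · simp only [Plant.closedLoop, fromBlocks_multiply, Matrix.one_mul, Matrix.mul_one,
      Matrix.zero_mul, Matrix.mul_zero, Matrix.mul_neg, Matrix.neg_mul, add_zero, zero_add, neg_neg]
    congr 1
    · abel
    · rw [hAe]; abel
    · rw [hAe]; abel
  · simp only [Plant.closedLoop, fromBlocks_mul_fromRows, Matrix.one_mul, Matrix.zero_mul,
      Matrix.neg_mul, add_zero]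
    rw [hBe, ← sub_eq_add_neg, sub_sub_cancel]
  · simp only [Plant.closedLoop, fromCols_mul_fromBlocks, Matrix.mul_one, Matrix.mul_zero,
      Matrix.mul_neg, neg_neg, zero_add, add_neg_cancel_right]
  · rw [IsSymm, fromBlocks_transpose, hXt.eq, hWt, transpose_zero]
  · simp only [fromBlocks_transpose, transpose_fromCols, transpose_fromRows, fromBlocks_multiply,
      fromRows_mul_fromCols, fromBlocks_add, fromBlocks_mul_fromRows,
      Matrix.mul_zero, Matrix.zero_mul, add_zero, zero_add, Matrix.mul_assoc]
    rw [← fromBlocks_zero]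
    congr 1
    · linear_combination (norm := (simp only [Matrix.mul_assoc]; abel)) hstate
    · have h := hcross
      simp only [Matrix.mul_neg, Matrix.neg_mul, transpose_neg, transpose_mul, hXt.eq,
        transpose_transpose, Matrix.mul_assoc] at h ⊢
      linear_combination (norm := abel) -h
    · have h := congrArg transpose hcross
      simp only [Matrix.mul_neg, Matrix.neg_mul, transpose_neg, transpose_add, transpose_mul,
        transpose_transpose, transpose_zero, hXt.eq, Matrix.mul_assoc] at h ⊢
      linear_combination (norm := abel) -h
    · have h := hWric
      simp only [Plant.E₁, Matrix.mul_neg, Matrix.neg_mul, neg_neg, transpose_neg, transpose_mul,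
        hWt, Matrix.mul_assoc] at h ⊢
      linear_combination (norm := abel) h
  -- The lower left block is `-Be B₁ᵀ X + Be B₁ᵀ X = 0`, and the upper left one is the stabilized
  -- control matrix.
  · have h : fromBlocks (S.A + S.B₂ * F) (-(S.B₂ * F)) (-(Be * S.B₁ᵀ * X)) Ae +
        fromRows S.B₁ Be * (fromRows S.B₁ Be)ᵀ * fromBlocks X 0 0 W =
        fromBlocks (S.A - S.B₂ * S.E₁⁻¹ * S.D₁₂ᵀ * S.C₁ +
          (S.B₁ * S.B₁ᵀ - S.B₂ * S.E₁⁻¹ * S.B₂ᵀ) * X) (-(S.B₂ * F) + S.B₁ * Beᵀ * W) 0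
          (Ae + Be * Beᵀ * W) := by
      simp only [transpose_fromRows, fromRows_mul_fromCols, fromBlocks_multiply, fromBlocks_add,
        Matrix.mul_zero, add_zero, zero_add, neg_add_cancel]
      congr 1
      rw [hF]
      simp only [Matrix.mul_add, Matrix.sub_mul, Matrix.mul_neg, Matrix.mul_assoc]
      abel
    rw [h]
    exact re_ne_zero_of_mem_spectrum_fromBlocks hXstab hYstab hVY hsim
  · obtain ⟨⟨v, hv⟩, -⟩ := hXpd.exists_neg_and_pos_on_hyperplane
    refine ⟨Sum.elim v 0, ?_⟩
    rw [dotProduct_fromBlocks_diagonal]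
    simpa using hv
  -- As `W` is positive definite, `diag(X, W)` is positive on the hyperplane obtained by extending
  -- `u` by zero.
  · obtain ⟨-, u, hu⟩ := hXpd.exists_neg_and_pos_on_hyperplane
    refine ⟨Sum.elim u 0, fun x hx hux => ?_⟩
    rw [dotProduct_fromBlocks_diagonal]
    have hux' : u ⬝ᵥ (x ∘ Sum.inl) = 0 := by
      simpa [dotProduct, Fintype.sum_sum_type] using hux
    have hWnn : 0 ≤ (x ∘ Sum.inr) ⬝ᵥ W *ᵥ (x ∘ Sum.inr) := by
      simpa using hWpd.posSemidef.dotProduct_mulVec_nonneg (x ∘ Sum.inr)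
    by_cases h : x ∘ Sum.inl = 0
    · have h' : x ∘ Sum.inr ≠ 0 := fun h' => hx (by
        ext i
        cases i with
        | inl i => exact congrFun h i
        | inr i => exact congrFun h' i)
      rw [h, zero_dotProduct, zero_add]
      simpa using hWpd.dotProduct_mulVec_pos h'
    · exact add_pos_of_pos_of_nonneg (hu _ h hux') hWnn

end PseudoHInf

end

theorem mainTheorem6 (n m q p : ℕ) (S : PseudoHInf.Plant n m q p)
    (hE₁ : S.E₁.PosDef) (hE₂ : S.E₂.PosDef)
    (X Y : Matrix (Fin n) (Fin n) ℝ)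
    (hX : S.IsStabilizingX X) (hXpd : PseudoHInf.IsPseudoPosDef X)
    (hY : S.IsStabilizingY Y) (hYpd : Y.PosDef)
    (hXY : PseudoHInf.specRadius (X * Y) < 1) :
    IsUnit (1 - Y * X) ∧
      ∃ K : PseudoHInf.Compensator n q p,
        K.Cc = -(S.E₁⁻¹ * (S.B₂ᵀ * X + S.D₁₂ᵀ * S.C₁)) ∧
        K.Bc = (1 - Y * X)⁻¹ * (Y * S.C₂ᵀ + S.B₁ * S.D₂₁ᵀ) * S.E₂⁻¹ ∧
        K.Ac = S.A + S.B₂ * K.Cc - K.Bc * S.C₂ + (S.B₁ - K.Bc * S.D₂₁) * S.B₁ᵀ * X ∧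
        (S.closedLoop K).IsPseudoStrictBoundedReal :=
  PseudoHInf.Plant.exists_compensator_isPseudoStrictBoundedReal n m q p S hE₁ hE₂ X Y hX hXpd
    hY hYpd hXY
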